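/- Let $1\le k\le n$ and $J=[n]\sqcup[n]^*$ with its involution $a\mapsto a^*$. Call $A\subseteq J$ admissible if $A\cap A^*=\emptyset$, and let $U^*_{k,n}$ be the family of all admissible subsets of $J$ of size $k$. For a matroid $M$ on $J$, let $I^{ad}(M)$ be the family of independent sets of $M$ whose closure is admissible. A loopless matroid $M$ on $J$ is called admissible if for every $A\subseteq J$ $$r_M(A)=\max_{I}\begin{cases}|I|+2 & \text{if there is } \{a,a^*\}\subseteq A \text{ with } I\cup\{a\},\,I\cup\{a^*\}\in I^{ad}(M),\\ |I| & \text{otherwise,}\end{cases}$$ where $I$ runs over the admissible independent sets of $M$ contained in $A$. The enveloping matroid of a family $\mathcal S$ of subsets of $J$ is the admissible matroid whose family of admissible bases is $\mathcal S$ and whose dependent sets are dependent in every other admissible matroid whose family of admissible bases is $\mathcal S$. If $\mathcal S$ has the enveloping matroid $M$, let $L(\mathcal S)$ consist of the admissible flats of $M$ and of $J$. The Bergman fan $B(\mathcal S)$ is the collection of the cones in $\mathbb R^n$ spanned with nonnegative coefficients by the vectors $e_F^{\pm}$, $F\in\mathcal F$, where $\mathcal F$ runs over the (possibly empty) chains in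 $L(\mathcal S)\setminus\{\emptyset,J\}$ and $e^{\pm}_F=\sum_{i\in F\cap[n]}e_i-\sum_{i^*\in F\cap[n]^*}e_i$. A Minkowski weight of dimension $d$ on a finite fan $\Sigma$ in $\mathbb R^n$ is a function $c:\Sigma_d\to\mathbb Z$ on its $d$-dimensional cones such that, for every $(d-1)$-dimensional cone $\tau\in\Sigma$, the sum $\sum_{\tau\subset\sigma\in\Sigma_d}c(\sigma)\,e_{\sigma/\tau}$ lies in the linear span of $\tau$, for any representatives $e_{\sigma/\tau}\in\sigma$ of generators of $N_\sigma/N_\tau$, where $N_\sigma=\mathbb Z^n\cap\operatorname{span}\sigma$; these form a group $MW_d(\Sigma)$. Then $U^*_{k,n}$ has a unique enveloping matroid, and $$MW_{k-1}(B(U^*_{k,n}))\cong\mathbb Z^{\binom{n}{k-1}}.$$ In particular, for $k\ge 2$ this group is not isomorphic to $\mathbb Z$. -/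

import Mathlib

open Module

namespace SympMatroid

/-! ### The ground set `J = [n] ⊔ [n]*` -/

/-- The ground set `J = [n] ⊔ [n]*`: `Sum.inl i` is `i` and `Sum.inr i` is `i*`. -/
abbrev Ground (n : ℕ) : Type := Fin n ⊕ Fin n

/-- The involution `a ↦ a*` of `J`. -/
def star {n : ℕ} (a : Ground n) : Ground n := a.swap

/-- `A ⊆ J` is admissible if `A ∩ A* = ∅`. -/
def Admissible {n : ℕ} (A : Set (Ground n)) : Prop := A ∩ star '' A = ∅

/-! ### Admissible matroids, ranked symplectic matroids, lattices of flats -/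

/-- The family `I^ad(M)` of independent sets of `M` with admissible closure. -/
def admIndep {n : ℕ} (M : Matroid (Ground n)) : Set (Set (Ground n)) :=
  {I | M.Indep I ∧ Admissible (M.closure I)}

open Classical in
/-- The quantity maximized over `I` in the rank formula of an admissible matroid: `|I| + 2` if
some pair `{a, a*} ⊆ A` has `I ∪ {a}, I ∪ {a*} ∈ I^ad(M)`, and `|I|` otherwise. -/
noncomputable def rankValue {n : ℕ} (M : Matroid (Ground n)) (A I : Set (Ground n)) : ℕ∞ :=
  if ∃ a, a ∈ A ∧ star a ∈ A ∧ insert a I ∈ admIndep M ∧ insert (star a) I ∈ admIndep M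
  then I.encard + 2 else I.encard

/-- A loopless matroid on `J` is admissible if the rank of every `A ⊆ J` is the maximum of
`rankValue M A I` over the admissible independent sets `I ⊆ A`. -/
structure IsAdmissibleMatroid {n : ℕ} (M : Matroid (Ground n)) : Prop where
  ground_eq : M.E = Set.univ
  loopless : M.Loopless
  rank_eq : ∀ A : Set (Ground n),
    IsGreatest {r : ℕ∞ | ∃ I ⊆ A, M.Indep I ∧ Admissible I ∧ r = rankValue M A I} (M.eRk A)

/-- The family of admissible bases of a matroid on `J`. -/
def admissibleBases {n : ℕ} (M : Matroid (Ground n)) : Set (Set (Ground n)) :=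
  {B | M.IsBase B ∧ Admissible B}

/-- `M` is the (minimal) enveloping matroid of `S`: it is an admissible matroid with family of
admissible bases `S`, and among all these it has the smallest family of dependent sets. -/
structure IsEnvelopingMatroid {n : ℕ} (S : Set (Set (Ground n))) (M : Matroid (Ground n)) :
    Prop where
  admissible : IsAdmissibleMatroid M
  bases_eq : admissibleBases M = S
  minimal : ∀ M' : Matroid (Ground n), IsAdmissibleMatroid M' → admissibleBases M' = S →
    ∀ X : Set (Ground n), M.Dep X → M'.Dep X

/-- The uniform symplectic matroid `U*_{k,n}`: all admissible sets of size `k`. -/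
def uniform (k n : ℕ) : Set (Set (Ground n)) := {B | Admissible B ∧ B.ncard = k}

/-- The lattice of flats of the ranked symplectic matroid with enveloping matroid `M`: the
admissible flats of `M`, together with `J`. -/
def latticeOfFlats {n : ℕ} (M : Matroid (Ground n)) : Set (Set (Ground n)) :=
  {F | M.IsFlat F ∧ Admissible F} ∪ {Set.univ}

/-! ### The Bergman fan -/

/-- The vectors `e_i^± = e_i` and `e_{i*}^± = -e_i` of `ℝⁿ`. -/
noncomputable def signedUnit {n : ℕ} : Ground n → (Fin n → ℝ)
  | Sum.inl i => Pi.single i 1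
  | Sum.inr i => -Pi.single i 1

open Classical in
/-- The vector `e_F^± = ∑_{a ∈ F} e_a^±` of `ℝⁿ`. -/
noncomputable def signedVec {n : ℕ} (F : Set (Ground n)) : Fin n → ℝ :=
  ∑ a with a ∈ F, signedUnit a

/-- The cone in `ℝⁿ` spanned with nonnegative coefficients by the `e_F^±`, `F ∈ C`. -/
noncomputable def flagCone {n : ℕ} (C : Set (Set (Ground n))) : PointedCone ℝ (Fin n → ℝ) :=
  PointedCone.hull ℝ (signedVec '' C)

/-- The Bergman fan: the cones spanned by the chains (the empty one included) of
`L(S) \ {∅, J}`, where `S` is the ranked symplectic matroid with enveloping matroid `M`. -/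
def bergmanFan {n : ℕ} (M : Matroid (Ground n)) : Set (PointedCone ℝ (Fin n → ℝ)) :=
  {σ | ∃ C : Set (Set (Ground n)),
    C ⊆ latticeOfFlats M \ {∅, Set.univ} ∧ IsChain (· ⊆ ·) C ∧ σ = flagCone C}

instance bergmanFan_finite {n : ℕ} (M : Matroid (Ground n)) : Finite (bergmanFan M) := by
  refine Set.Finite.to_subtype ((Set.finite_range (flagCone (n := n))).subset ?_)
  rintro σ ⟨C, -, -, rfl⟩
  exact ⟨C, rfl⟩

/-! ### Minkowski weights on a finite fan in `ℝⁿ` with lattice `ℤⁿ` -/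

/-- The dimension of a cone: the dimension of its linear span. -/
noncomputable def coneDim {n : ℕ} (σ : PointedCone ℝ (Fin n → ℝ)) : ℕ :=
  finrank ℝ (Submodule.span ℝ (σ : Set (Fin n → ℝ)))

/-- The `d`-dimensional cones of a collection of cones. -/
def conesOfDim {n : ℕ} (Δ : Set (PointedCone ℝ (Fin n → ℝ))) (d : ℕ) :
    Set (PointedCone ℝ (Fin n → ℝ)) :=
  {σ | σ ∈ Δ ∧ coneDim σ = d}

/-- The lattice `ℤⁿ` in `ℝⁿ`. -/
def integerLattice (n : ℕ) : AddSubgroup (Fin n → ℝ) :=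
  ((Int.castAddHom ℝ).compLeft (Fin n)).range

/-- `N_σ`: the lattice points in the linear span of `σ`. -/
def coneLattice {n : ℕ} (σ : PointedCone ℝ (Fin n → ℝ)) : AddSubgroup (Fin n → ℝ) :=
  integerLattice n ⊓ (Submodule.span ℝ (σ : Set (Fin n → ℝ))).toAddSubgroup

/-- `u` is a representative in `σ` of a generator of `N_σ / N_τ`. -/
def IsNormalVector {n : ℕ} (τ σ : PointedCone ℝ (Fin n → ℝ)) (u : Fin n → ℝ) : Prop :=
  u ∈ σ ∧ coneLattice σ = coneLattice τ ⊔ AddSubgroup.zmultiples u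

/-- The balancing condition for a weight `c` of dimension `d`: for every `(d-1)`-dimensional cone
`τ` and all choices of representatives `e_{σ/τ} ∈ σ`, the sum of `c(σ) e_{σ/τ}` over the
`d`-dimensional cones `σ ⊇ τ` lies in the linear span of `τ`. -/
def IsBalanced {n : ℕ} (Δ : Set (PointedCone ℝ (Fin n → ℝ))) (d : ℕ)
    (c : conesOfDim Δ d → ℤ) : Prop :=
  ∀ τ ∈ Δ, coneDim τ + 1 = d →
    ∀ u : conesOfDim Δ d → (Fin n → ℝ),
      (∀ σ : conesOfDim Δ d, τ ≤ σ.1 → IsNormalVector τ σ.1 (u σ)) →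
      ∑ᶠ (σ : conesOfDim Δ d) (_ : τ ≤ σ.1), c σ • u σ ∈
        Submodule.span ℝ (τ : Set (Fin n → ℝ))

/-- The group `MW_d(Δ)` of Minkowski weights of dimension `d` on a finite fan `Δ`, as a subgroup
of the group of all integer weights on the `d`-dimensional cones. -/
def minkowskiWeights {n : ℕ} (Δ : Set (PointedCone ℝ (Fin n → ℝ))) [Finite Δ] (d : ℕ) :
    AddSubgroup (conesOfDim Δ d → ℤ) where
  carrier := {c | IsBalanced Δ d c}
  zero_mem' := by
    intro τ _ _ u _
    simp
  add_mem' := by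
    intro c c' hc hc' τ hτ hd u hu
    have hfin : Finite (conesOfDim Δ d) :=
      ((Set.toFinite Δ).subset fun _ h => h.1).to_subtype
    have h := Submodule.add_mem _ (hc τ hτ hd u hu) (hc' τ hτ hd u hu)
    rw [← finsum_add_distrib (Set.toFinite _) (Set.toFinite _)] at h
    convert h using 3 with σ
    by_cases hσ : τ ≤ σ.1 <;> simp [hσ, add_smul]
  neg_mem' := by
    intro c hc τ hτ hd u hu
    have h := Submodule.neg_mem _ (hc τ hτ hd u hu)
    simpa only [← finsum_neg_distrib, Pi.neg_apply, neg_smul] using h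

end SympMatroid

namespace SympMatroid

/-! ### The underlying index of an element of `J` -/

/-! The candidate matroid `uniformEnvelope k n` has as independent sets those with at most `k`
elements and at most one pair `{a, a*}`. An independent set of any admissible matroid contains at
most one pair, by the rank formula (`IsAdmissibleMatroid.ncard_le_of_indep`), and has at most `k`
elements if the admissible bases have size `k`; this gives minimality, and minimality gives
uniqueness. Admissible sets with fewer than `k` elements are closed and larger ones span a base, so
the admissible flats are the admissible sets of size at most `d = k - 1`.

The Bergman fan is therefore the fan of chains of nonempty admissible sets of size at most `d`. Its
`d`-dimensional cones subdivide all coordinate subspaces of dimension `d`, and there are `n.choose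
d` of these. Flag cones are unimodular (`exists_separating_functional`), so balancing can be tested
with the vectors `signedVec G` (`isBalanced_iff`).

The extensions of a codimension-one flag `D` come in opposite pairs: swap two consecutive entries of
the complete flag, or replace the last entry `a` by `a*` (`exists_opposite`). Modulo the span of `D`
a pair has opposite vectors, and a functional separates it from all other extensions. Hence
balancing means equal weights on opposite cones. Swaps and sign changes connect all cones of one
coordinate subspace and preserve that subspace, so a Minkowski weight is an arbitrary integer
function on the coordinate subspaces of dimension `d`. -/

/-- The element of `[n]` underlying an element of `J`. -/
def index {n : ℕ} : Ground n → Fin n := Sum.elim id id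

@[simp] lemma index_inl {n : ℕ} (i : Fin n) : index (Sum.inl i : Ground n) = i := rfl

@[simp] lemma index_inr {n : ℕ} (i : Fin n) : index (Sum.inr i : Ground n) = i := rfl

@[simp] lemma index_star {n : ℕ} (a : Ground n) : index (star a) = index a := by
  cases a <;> rfl

@[simp] lemma star_star {n : ℕ} (a : Ground n) : star (star a) = a := by
  cases a <;> rfl

lemma star_ne_self {n : ℕ} (a : Ground n) : star a ≠ a := by
  cases a <;> simp [star]

lemma index_eq_iff {n : ℕ} {a b : Ground n} : index a = index b ↔ b = a ∨ b = star a := by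
  cases a <;> cases b <;> simp [star, eq_comm]

lemma admissible_iff {n : ℕ} {A : Set (Ground n)} : Admissible A ↔ ∀ a ∈ A, star a ∉ A := by
  simp only [Admissible, Set.eq_empty_iff_forall_notMem, Set.mem_inter_iff, Set.mem_image, not_and]
  constructor
  · intro h a ha hs
    exact h _ hs ⟨a, ha, rfl⟩
  · rintro h a ha ⟨b, hb, rfl⟩
    exact h b hb ha

lemma Admissible.subset {n : ℕ} {A B : Set (Ground n)} (hB : Admissible B) (h : A ⊆ B) :
    Admissible A := by
  rw [admissible_iff] at *
  exact fun a ha hs => hB a (h ha) (h hs)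

/-- The fibres of `index` are exactly the pairs `{a, a*}`, so admissibility can be handled by
counting indices. -/
lemma admissible_iff_injOn {n : ℕ} {A : Set (Ground n)} : Admissible A ↔ Set.InjOn index A := by
  rw [admissible_iff]
  constructor
  · intro h a ha b hb hab
    rcases index_eq_iff.1 hab with rfl | rfl
    · rfl
    · exact absurd hb (h a ha)
  · intro h a ha hs
    exact star_ne_self a (h hs ha (index_star a))

lemma Admissible.ncard_index {n : ℕ} {A : Set (Ground n)} (h : Admissible A) :
    (index '' A).ncard = A.ncard :=
  (admissible_iff_injOn.1 h).ncard_image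

lemma admissible_image_inl {n : ℕ} (s : Set (Fin n)) :
    Admissible (Sum.inl '' s : Set (Ground n)) := by
  rw [admissible_iff]
  rintro _ ⟨i, -, rfl⟩ ⟨j, -, h⟩
  cases h

lemma exists_admissible_ncard {n k : ℕ} (hkn : k ≤ n) :
    ∃ A : Set (Ground n), Admissible A ∧ A.ncard = k := by
  obtain ⟨s, -, hs⟩ := Finset.exists_subset_card_eq (s := (Finset.univ : Finset (Fin n))) (n := k)
    (by simpa using hkn)
  refine ⟨Sum.inl '' (s : Set (Fin n)), admissible_image_inl _, ?_⟩
  rw [Set.ncard_image_of_injective _ Sum.inl_injective, Set.ncard_coe_finset, hs]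

/-! ### The enveloping matroid of the uniform symplectic matroid -/

/-- The matroid on `J` whose independent sets have at most `k` elements and contain at most one
pair `{a, a*}`. -/
def uniformEnvelope (k n : ℕ) : Matroid (Ground n) :=
  (IndepMatroid.ofFinite (E := Set.univ) Set.finite_univ
    (fun X => X.ncard ≤ k ∧ X.ncard ≤ (index '' X).ncard + 1)
    (by simp)
    (by
      -- Heredity: deleting elements loses at most as many indices as elements.
      rintro I J ⟨h1, h2⟩ hIJ
      have h3 := Set.ncard_sdiff_add_ncard_of_subset hIJ
      have h4 : (index '' J).ncard ≤ (index '' I).ncard + (J \ I).ncard := by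
        calc (index '' J).ncard ≤ (index '' I ∪ index '' (J \ I)).ncard := by
              apply Set.ncard_le_ncard _ (Set.toFinite _)
              rw [← Set.image_union, Set.union_sdiff_cancel hIJ]
          _ ≤ _ := Set.ncard_union_le _ _
          _ ≤ _ := by gcongr; exact Set.ncard_image_le (Set.toFinite _)
      constructor <;> omega)
    (by
      rintro I J ⟨h1, h2⟩ ⟨h3, h4⟩ hIJ
      -- Exchange: an element with a new index raises both sides of the pair bound by one. If `J`
      -- has no more indices than `I`, then `|I| < |J|` leaves slack in the bound for `I`, and any
      -- element of `J \ I` works.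
      by_cases hlt : (index '' I).ncard < (index '' J).ncard
      · obtain ⟨_, ⟨e, he, rfl⟩, heI⟩ := Set.exists_mem_notMem_of_ncard_lt_ncard hlt
        have heI' : e ∉ I := fun h => heI ⟨e, h, rfl⟩
        refine ⟨e, he, heI', ?_⟩
        rw [Set.image_insert_eq, Set.ncard_insert_of_notMem heI (Set.toFinite _),
          Set.ncard_insert_of_notMem heI' (Set.toFinite _)]
        constructor <;> omega
      · obtain ⟨e, he, heI⟩ := Set.exists_mem_notMem_of_ncard_lt_ncard hIJ
        have h5 : (index '' I).ncard ≤ (index '' insert e I).ncard :=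
          Set.ncard_le_ncard (Set.image_mono (Set.subset_insert _ _)) (Set.toFinite _)
        refine ⟨e, he, heI, ?_⟩
        rw [Set.ncard_insert_of_notMem heI (Set.toFinite _)]
        constructor <;> omega)
    (by simp)).matroid

lemma uniformEnvelope_ground {k n : ℕ} : (uniformEnvelope k n).E = Set.univ := rfl

lemma uniformEnvelope_indep_iff {k n : ℕ} {X : Set (Ground n)} :
    (uniformEnvelope k n).Indep X ↔ X.ncard ≤ k ∧ X.ncard ≤ (index '' X).ncard + 1 := Iff.rfl

lemma uniformEnvelope_indep_of_admissible {k n : ℕ} {X : Set (Ground n)} (h : Admissible X)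
    (hX : X.ncard ≤ k) : (uniformEnvelope k n).Indep X :=
  uniformEnvelope_indep_iff.2 ⟨hX, by rw [h.ncard_index]; omega⟩

lemma uniformEnvelope_isBase_of_ncard {k n : ℕ} {X : Set (Ground n)}
    (h : (uniformEnvelope k n).Indep X) (hX : X.ncard = k) : (uniformEnvelope k n).IsBase X := by
  rw [Matroid.isBase_iff_maximal_indep]
  refine ⟨h, fun Y hY hXY => ?_⟩
  have := (uniformEnvelope_indep_iff.1 hY).1
  exact (Set.eq_of_subset_of_ncard_le hXY (by omega) (Set.toFinite _)).ge

lemma uniformEnvelope_isBase_iff {k n : ℕ} (hkn : k ≤ n) {X : Set (Ground n)} :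
    (uniformEnvelope k n).IsBase X ↔ (uniformEnvelope k n).Indep X ∧ X.ncard = k := by
  refine ⟨fun h => ⟨h.indep, ?_⟩, fun h => uniformEnvelope_isBase_of_ncard h.1 h.2⟩
  obtain ⟨B, hB, hBk⟩ := exists_admissible_ncard hkn
  have hB' := uniformEnvelope_isBase_of_ncard
    (uniformEnvelope_indep_of_admissible hB hBk.le) hBk
  rw [← hBk]
  exact h.ncard_eq_ncard_of_isBase hB'

lemma uniformEnvelope_admissibleBases {k n : ℕ} (hkn : k ≤ n) :
    admissibleBases (uniformEnvelope k n) = uniform k n := by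
  ext B
  simp only [admissibleBases, uniform, Set.mem_ofPred_eq, uniformEnvelope_isBase_iff hkn]
  exact ⟨fun h => ⟨h.2, h.1.2⟩,
    fun h => ⟨⟨uniformEnvelope_indep_of_admissible h.1 h.2.le, h.2⟩, h.1⟩⟩

/-- One extra element creates at most one pair, and the size bound still has room for it. -/
lemma uniformEnvelope_closure {k n : ℕ} {X : Set (Ground n)} (h : Admissible X)
    (hX : X.ncard < k) : (uniformEnvelope k n).closure X = X := by
  have hI := uniformEnvelope_indep_of_admissible h hX.le
  refine subset_antisymm (fun e he => ?_) (Matroid.subset_closure _ _ (Set.subset_univ _))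
  by_contra heX
  rw [hI.mem_closure_iff_of_notMem heX] at he
  refine he.not_indep (uniformEnvelope_indep_iff.2 ?_)
  have h1 : (index '' X).ncard ≤ (index '' insert e X).ncard :=
    Set.ncard_le_ncard (Set.image_mono (Set.subset_insert _ _)) (Set.toFinite _)
  rw [h.ncard_index] at h1
  rw [Set.ncard_insert_of_notMem heX (Set.toFinite _)]
  constructor <;> omega

lemma not_admissible_univ {n : ℕ} (hn : 1 ≤ n) : ¬ Admissible (Set.univ : Set (Ground n)) := by
  rw [admissible_iff]
  exact fun h => h (Sum.inl ⟨0, hn⟩) trivial trivial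

/-- Otherwise the set contains `k` elements forming a base, whose closure is all of `J`. -/
lemma ncard_lt_of_admissible_closure {k n : ℕ} (hn : 1 ≤ n) {X : Set (Ground n)}
    (h : Admissible ((uniformEnvelope k n).closure X)) : X.ncard < k := by
  by_contra! hX
  obtain ⟨Y, hYX, hY⟩ := Set.exists_subset_card_eq hX
  have hadm : Admissible Y :=
    h.subset (hYX.trans (Matroid.subset_closure _ _ (Set.subset_univ _)))
  have hB := uniformEnvelope_isBase_of_ncard (uniformEnvelope_indep_of_admissible hadm hY.le) hY
  refine not_admissible_univ hn (h.subset ?_)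
  rw [← uniformEnvelope_ground (k := k), ← hB.closure_eq]
  exact Matroid.closure_subset_closure _ hYX

lemma uniformEnvelope_flat_admissible_iff {k n : ℕ} (hn : 1 ≤ n) {F : Set (Ground n)} :
    ((uniformEnvelope k n).IsFlat F ∧ Admissible F) ↔ Admissible F ∧ F.ncard < k := by
  rw [Matroid.isFlat_iff_closure_eq]
  constructor
  · rintro ⟨h, hF⟩
    exact ⟨hF, ncard_lt_of_admissible_closure hn (by rwa [h])⟩
  · rintro ⟨hF, h⟩
    exact ⟨uniformEnvelope_closure hF h, hF⟩

lemma admissible_of_mem_admIndep {n : ℕ} {M : Matroid (Ground n)} (hE : M.E = Set.univ)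
    {I : Set (Ground n)} (h : I ∈ admIndep M) : Admissible I :=
  h.2.subset (M.subset_closure I (by simp [hE]))

lemma notMem_of_insert_mem_admIndep {n : ℕ} {M : Matroid (Ground n)} (hE : M.E = Set.univ)
    {I : Set (Ground n)} {a : Ground n} (h : insert (star a) I ∈ admIndep M) : a ∉ I := by
  intro ha
  exact admissible_iff.1 (admissible_of_mem_admIndep hE h) a (Set.mem_insert_of_mem _ ha)
    (Set.mem_insert _ _)

lemma encard_le_rankValue {n : ℕ} (M : Matroid (Ground n)) (A I : Set (Ground n)) :
    I.encard ≤ rankValue M A I := by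
  unfold rankValue
  split_ifs
  · exact le_self_add
  · exact le_rfl

/-- In the pair case `I ∪ {a, a*}` is an independent subset of `A`: it has a single pair, and `I ∪
{a}` has fewer than `k` elements because its closure is admissible. -/
lemma uniformEnvelope_rankValue_le {k n : ℕ} (hn : 1 ≤ n) {A I : Set (Ground n)} (hIA : I ⊆ A)
    (hI : (uniformEnvelope k n).Indep I) :
    rankValue (uniformEnvelope k n) A I ≤ (uniformEnvelope k n).eRk A := by
  unfold rankValue
  split_ifs with h
  · obtain ⟨a, ha, hs, h1, h2⟩ := h
    have haI : a ∉ I := notMem_of_insert_mem_admIndep uniformEnvelope_ground h2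
    have hsI : star a ∉ insert a I := by
      rw [Set.mem_insert_iff, not_or]
      refine ⟨star_ne_self a, ?_⟩
      exact notMem_of_insert_mem_admIndep uniformEnvelope_ground (by rwa [star_star])
    have hlt := ncard_lt_of_admissible_closure hn h1.2
    have hadm := admissible_of_mem_admIndep uniformEnvelope_ground h1
    have hind : (uniformEnvelope k n).Indep (insert (star a) (insert a I)) := by
      rw [uniformEnvelope_indep_iff, Set.image_insert_eq, index_star,
        Set.insert_eq_of_mem (Set.mem_image_of_mem index (Set.mem_insert a I)), hadm.ncard_index,
        Set.ncard_insert_of_notMem hsI (Set.toFinite _)]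
      exact ⟨hlt, le_rfl⟩
    have hle := hind.encard_le_eRk_of_subset
      (Set.insert_subset hs (Set.insert_subset ha hIA))
    rw [Set.encard_insert_of_notMem hsI, Set.encard_insert_of_notMem haI, add_assoc] at hle
    exact hle
  · exact hI.encard_le_eRk_of_subset hIA

/-- Let `T` be a transversal of the fibres of `index` on `A`. A basis of `A` has at most `|T| + 1`
elements. Up to `|T|`, a subset of `T` suffices; for `|T| + 1`, the pair case of the formula is
needed. -/
lemma uniformEnvelope_le_rankValue {k n : ℕ} (A : Set (Ground n)) :
    ∃ I ⊆ A, (uniformEnvelope k n).Indep I ∧ Admissible I ∧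
      (uniformEnvelope k n).eRk A ≤ rankValue (uniformEnvelope k n) A I := by
  obtain ⟨T, hTA, hT⟩ := Set.exists_subset_bijOn A index
  have hTadm : Admissible T := admissible_iff_injOn.2 hT.injOn
  have hcard : (index '' A).ncard = T.ncard := by rw [← hT.image_eq, hTadm.ncard_index]
  obtain ⟨B, hB⟩ := (uniformEnvelope k n).exists_isBasis A (Set.subset_univ _)
  have hBind := uniformEnvelope_indep_iff.1 hB.indep
  have hBT : B.ncard ≤ T.ncard + 1 := by
    have := Set.ncard_le_ncard (Set.image_mono (f := index) hB.subset) (Set.toFinite _)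
    omega
  rw [hB.eRk_eq_encard]
  by_cases hk : B.ncard ≤ T.ncard
  · obtain ⟨I, hIT, hI⟩ := Set.exists_subset_card_eq hk
    refine ⟨I, hIT.trans hTA, uniformEnvelope_indep_of_admissible (hTadm.subset hIT) (by omega),
      hTadm.subset hIT, ?_⟩
    refine le_trans (le_of_eq ?_) (encard_le_rankValue _ _ _)
    rw [← (Set.toFinite B).cast_ncard_eq, ← (Set.toFinite I).cast_ncard_eq, hI]
  · have hBA := Set.ncard_le_ncard hB.subset (Set.toFinite _)
    obtain ⟨b, hbA, hbT⟩ := Set.exists_mem_notMem_of_ncard_lt_ncard (s := T) (t := A) (by omega)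
    obtain ⟨a, haT, hab⟩ := hT.surjOn (Set.mem_image_of_mem index hbA)
    rcases index_eq_iff.1 hab with rfl | rfl
    · exact absurd haT hbT
    have hTa : insert a (T \ {a}) = T := by simp [Set.insert_eq_of_mem haT]
    have hadm : Admissible (insert (star a) (T \ {a})) := by
      rw [admissible_iff_injOn, Set.injOn_insert (fun h => hbT h.1)]
      refine ⟨hT.injOn.mono Set.sdiff_subset, ?_⟩
      rintro ⟨c, ⟨hc, hca⟩, hc'⟩
      exact hca (hT.injOn hc haT (by simpa using hc'))
    have hcT := Set.ncard_sdiff_singleton_add_one haT (Set.toFinite _)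
    have hcs : (insert (star a) (T \ {a})).ncard = T.ncard := by
      rw [Set.ncard_insert_of_notMem (fun h => hbT h.1) (Set.toFinite _), hcT]
    -- Both completions, by `a` and by `a*`, have `|T| < |B| ≤ k` elements, hence are closed.
    refine ⟨T \ {a}, Set.sdiff_subset.trans hTA,
      uniformEnvelope_indep_of_admissible (hTadm.subset Set.sdiff_subset) (by omega),
      hTadm.subset Set.sdiff_subset, ?_⟩
    unfold rankValue
    rw [if_pos]
    · rw [← (Set.toFinite B).cast_ncard_eq, ← (Set.toFinite (T \ {a})).cast_ncard_eq]
      exact_mod_cast (by omega : B.ncard ≤ (T \ {a}).ncard + 2)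
    · refine ⟨a, hTA haT, hbA, ?_, ?_⟩
      · rw [hTa]
        refine ⟨uniformEnvelope_indep_of_admissible hTadm (by omega), ?_⟩
        rwa [uniformEnvelope_closure hTadm (by omega)]
      · refine ⟨uniformEnvelope_indep_of_admissible hadm (by omega), ?_⟩
        rwa [uniformEnvelope_closure hadm (by omega)]

lemma uniformEnvelope_isAdmissibleMatroid {k n : ℕ} (hn : 1 ≤ n) (hk : 1 ≤ k) :
    IsAdmissibleMatroid (uniformEnvelope k n) where
  ground_eq := uniformEnvelope_ground
  loopless := by
    rw [Matroid.loopless_iff, Matroid.loops, uniformEnvelope_closure]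
    · simp [admissible_iff]
    · simpa using Nat.pos_of_ne_zero (Nat.one_le_iff_ne_zero.1 hk)
  rank_eq A := by
    constructor
    · obtain ⟨I, hIA, hI, hadm, hle⟩ := uniformEnvelope_le_rankValue (k := k) A
      exact ⟨I, hIA, hI, hadm, le_antisymm hle (uniformEnvelope_rankValue_le hn hIA hI)⟩
    · rintro _ ⟨I, hIA, hI, -, rfl⟩
      exact uniformEnvelope_rankValue_le hn hIA hI

/-- In the pair case `|X| = |I| + 2`, while the admissible set `I ∪ {a}` already uses `|I| + 1`
indices of `X`. -/
lemma IsAdmissibleMatroid.ncard_le_of_indep {n : ℕ} {M : Matroid (Ground n)}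
    (hM : IsAdmissibleMatroid M) {X : Set (Ground n)} (hX : M.Indep X) :
    X.ncard ≤ (index '' X).ncard + 1 := by
  obtain ⟨I, hIX, -, hI, hr⟩ := (hM.rank_eq X).1
  rw [hX.eRk_eq_encard] at hr
  unfold rankValue at hr
  split_ifs at hr with h
  · obtain ⟨a, ha, -, h1, h2⟩ := h
    have haI : a ∉ I := notMem_of_insert_mem_admIndep hM.ground_eq h2
    have hadm := admissible_of_mem_admIndep hM.ground_eq h1
    have h3 : (index '' insert a I).ncard ≤ (index '' X).ncard :=
      Set.ncard_le_ncard (Set.image_mono (Set.insert_subset ha hIX)) (Set.toFinite _)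
    rw [hadm.ncard_index, Set.ncard_insert_of_notMem haI (Set.toFinite _)] at h3
    rw [← (Set.toFinite X).cast_ncard_eq, ← (Set.toFinite I).cast_ncard_eq] at hr
    have : X.ncard = I.ncard + 2 := by exact_mod_cast hr
    omega
  · have h3 : (index '' I).ncard ≤ (index '' X).ncard :=
      Set.ncard_le_ncard (Set.image_mono hIX) (Set.toFinite _)
    rw [hI.ncard_index] at h3
    rw [← (Set.toFinite X).cast_ncard_eq, ← (Set.toFinite I).cast_ncard_eq] at hr
    have : X.ncard = I.ncard := by exact_mod_cast hr
    omega

lemma uniformEnvelope_isEnvelopingMatroid {k n : ℕ} (hk : 1 ≤ k) (hkn : k ≤ n) :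
    IsEnvelopingMatroid (uniform k n) (uniformEnvelope k n) where
  admissible := uniformEnvelope_isAdmissibleMatroid (hk.trans hkn) hk
  bases_eq := uniformEnvelope_admissibleBases hkn
  minimal M hM hbases X hX := by
    rw [← Matroid.not_indep_iff (by simp [hM.ground_eq])]
    intro hind
    refine hX.not_indep (uniformEnvelope_indep_iff.2 ⟨?_, hM.ncard_le_of_indep hind⟩)
    -- One admissible base of size `k` fixes the size of all bases of `M`.
    obtain ⟨A, hA, hAk⟩ := exists_admissible_ncard hkn
    have hAb : A ∈ admissibleBases M := hbases ▸ ⟨hA, hAk⟩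
    obtain ⟨B, hB, hXB⟩ := hind.exists_isBase_superset
    rw [← hAk, ← hB.ncard_eq_ncard_of_isBase hAb.1]
    exact Set.ncard_le_ncard hXB (Set.toFinite _)

lemma IsEnvelopingMatroid.unique {n : ℕ} {S : Set (Set (Ground n))} {M M' : Matroid (Ground n)}
    (h : IsEnvelopingMatroid S M) (h' : IsEnvelopingMatroid S M') : M = M' := by
  have hE : M.E = M'.E := h.admissible.ground_eq.trans h'.admissible.ground_eq.symm
  refine Matroid.ext_indep hE fun X hX => ?_
  rw [← not_iff_not, Matroid.not_indep_iff hX, Matroid.not_indep_iff (hE ▸ hX)]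
  exact ⟨h.minimal M' h'.admissible h'.bases_eq X, h'.minimal M h.admissible h.bases_eq X⟩

/-! ### Signed coordinates -/

/-- The coordinate functional dual to `signedUnit a`. -/
def coord {n : ℕ} : Ground n → (Fin n → ℝ) →ₗ[ℝ] ℝ
  | Sum.inl i => LinearMap.proj i
  | Sum.inr i => -LinearMap.proj i

open Classical in
lemma signedVec_apply {n : ℕ} (F : Set (Ground n)) (i : Fin n) :
    signedVec F i = (if Sum.inl i ∈ F then 1 else 0) - if Sum.inr i ∈ F then 1 else 0 := by
  have h (p : Fin n → Prop) :
      (∑ j, if p j then (Pi.single j (1 : ℝ) : Fin n → ℝ) i else 0) = if p i then 1 else 0 := by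
    rw [Finset.sum_eq_single i]
    · simp
    · intro j _ hj
      simp [Pi.single_eq_of_ne hj.symm]
    · simp
  have h2 (p : Fin n → Prop) :
      (∑ j, if p j then -(Pi.single j (1 : ℝ) : Fin n → ℝ) i else 0) =
        - if p i then 1 else 0 := by
    rw [← h, ← Finset.sum_neg_distrib]
    exact Finset.sum_congr rfl fun j _ => by split_ifs <;> simp
  rw [signedVec, Finset.sum_filter, Fintype.sum_sum_type, Pi.add_apply, Finset.sum_apply,
    Finset.sum_apply, sub_eq_add_neg, ← h fun i => Sum.inl i ∈ F, ← h2 fun i => Sum.inr i ∈ F]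
  congr 1
  · exact Finset.sum_congr rfl fun j _ => by split_ifs <;> simp [signedUnit]
  · exact Finset.sum_congr rfl fun j _ => by split_ifs <;> simp [signedUnit]

open Classical in
lemma coord_signedVec {n : ℕ} (a : Ground n) (F : Set (Ground n)) :
    coord a (signedVec F) = (if a ∈ F then 1 else 0) - if star a ∈ F then 1 else 0 := by
  cases a with
  | inl i =>
    simp [coord, signedVec_apply, star]
    congr
  | inr i =>
    simp [coord, signedVec_apply, star]
    congr

lemma coord_signedVec_of_mem {n : ℕ} {a : Ground n} {F : Set (Ground n)} (hF : Admissible F)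
    (ha : a ∈ F) : coord a (signedVec F) = 1 := by
  simp [coord_signedVec, ha, admissible_iff.1 hF a ha]

lemma coord_signedVec_of_notMem {n : ℕ} {a : Ground n} {F : Set (Ground n)}
    (ha : a ∉ F) (hs : star a ∉ F) : coord a (signedVec F) = 0 := by
  simp [coord_signedVec, ha, hs]

lemma coord_signedVec_le_zero {n : ℕ} {a : Ground n} {F : Set (Ground n)}
    (ha : a ∉ F) : coord a (signedVec F) ≤ 0 := by
  rw [coord_signedVec, if_neg ha]
  split_ifs <;> norm_num

lemma mem_of_one_le_coord {n : ℕ} {a : Ground n} {F : Set (Ground n)}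
    (h : 1 ≤ coord a (signedVec F)) : a ∈ F := by
  by_contra ha
  linarith [coord_signedVec_le_zero ha]

lemma mem_integerLattice {n : ℕ} {x : Fin n → ℝ} :
    x ∈ integerLattice n ↔ ∀ i, ∃ m : ℤ, x i = m := by
  constructor
  · rintro ⟨y, rfl⟩ i
    exact ⟨y i, rfl⟩
  · intro h
    choose y hy using h
    exact ⟨y, funext fun i => (hy i).symm⟩

lemma coord_integer {n : ℕ} (a : Ground n) {x : Fin n → ℝ} (hx : x ∈ integerLattice n) :
    ∃ m : ℤ, coord a x = m := by
  rw [mem_integerLattice] at hx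
  cases a with
  | inl i => exact hx i
  | inr i =>
    obtain ⟨m, hm⟩ := hx i
    exact ⟨-m, by simp [coord, hm]⟩

lemma signedVec_mem_integerLattice {n : ℕ} (F : Set (Ground n)) :
    signedVec F ∈ integerLattice n := by
  classical
  rw [mem_integerLattice]
  intro i
  refine ⟨(if Sum.inl i ∈ F then 1 else 0) - if Sum.inr i ∈ F then 1 else 0, ?_⟩
  rw [signedVec_apply]
  push_cast
  rfl

/-! ### Flags of admissible sets and their cones -/

/-- A chain of nonempty admissible sets with at most `d` elements. -/
structure IsFlag {n : ℕ} (d : ℕ) (C : Set (Set (Ground n))) : Prop where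
  admissible : ∀ F ∈ C, Admissible F
  nonempty : ∀ F ∈ C, F.Nonempty
  ncard_le : ∀ F ∈ C, F.ncard ≤ d
  chain : IsChain (· ⊆ ·) C

lemma IsFlag.mono {n d : ℕ} {C D : Set (Set (Ground n))} (hC : IsFlag d C) (h : D ⊆ C) :
    IsFlag d D where
  admissible F hF := hC.admissible F (h hF)
  nonempty F hF := hC.nonempty F (h hF)
  ncard_le F hF := hC.ncard_le F (h hF)
  chain := hC.chain.mono h

lemma IsFlag.eq_of_ncard_eq {n d : ℕ} {C : Set (Set (Ground n))} (hC : IsFlag d C)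
    {F G : Set (Ground n)} (hF : F ∈ C) (hG : G ∈ C) (h : F.ncard = G.ncard) : F = G := by
  rcases hC.chain.total hF hG with h1 | h1
  · exact Set.eq_of_subset_of_ncard_le h1 h.ge (Set.toFinite _)
  · exact (Set.eq_of_subset_of_ncard_le h1 h.le (Set.toFinite _)).symm

/-- Take `a ∈ G` outside all smaller members and, if there are larger members, `b` in the next
larger one but not in `G`. Then `coord a - coord b`, or just `coord a`, reads off the coefficient of
`G`. Its integrality is the unimodularity of flag cones. -/
lemma exists_separating_functional {n d : ℕ} {D : Set (Set (Ground n))} {G : Set (Ground n)}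
    (hC : IsFlag d (insert G D)) (hG : G ∉ D) :
    ∃ f : (Fin n → ℝ) →ₗ[ℝ] ℝ, (∀ x ∈ integerLattice n, ∃ m : ℤ, f x = m) ∧
      (∀ F ∈ D, f (signedVec F) = 0) ∧ f (signedVec G) = 1 := by
  have hGC : G ∈ insert G D := Set.mem_insert _ _
  have hDC : ∀ F ∈ D, F ∈ insert G D := fun F => Set.mem_insert_of_mem _
  obtain ⟨a, haG, ha⟩ : ∃ a ∈ G, ∀ F ∈ D, F ⊆ G → a ∉ F := by
    rcases Set.eq_empty_or_nonempty {F ∈ D | F ⊆ G} with hS | hS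
    · obtain ⟨a, ha⟩ := hC.nonempty G hGC
      refine ⟨a, ha, fun F hF hFG => ?_⟩
      exact absurd (show F ∈ {F ∈ D | F ⊆ G} from ⟨hF, hFG⟩) (by simp [hS])
    · obtain ⟨H, ⟨hHD, hHG⟩, hmax⟩ := Set.exists_max_image _ Set.ncard (Set.toFinite _) hS
      have hne : ¬ G ⊆ H := fun h => hG (subset_antisymm hHG h ▸ hHD)
      obtain ⟨a, haG, haH⟩ := Set.not_subset.1 hne
      refine ⟨a, haG, fun F hF hFG haF => haH ?_⟩
      rcases hC.chain.total (hDC F hF) (hDC H hHD) with h | h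
      · exact h haF
      · exact (Set.eq_of_subset_of_ncard_le h (hmax F ⟨hF, hFG⟩) (Set.toFinite _)) ▸ haF
  have hsa : ∀ F ∈ D, F ⊆ G → star a ∉ F := fun F _ hFG h =>
    admissible_iff.1 (hC.admissible G hGC) a haG (hFG h)
  rcases Set.eq_empty_or_nonempty {F ∈ D | G ⊆ F} with hS | hS
  · refine ⟨coord a, fun x => coord_integer a, fun F hF => ?_,
      coord_signedVec_of_mem (hC.admissible G hGC) haG⟩
    rcases hC.chain.total (hDC F hF) hGC with h | h
    · exact coord_signedVec_of_notMem (ha F hF h) (hsa F hF h)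
    · exact absurd (show F ∈ {F ∈ D | G ⊆ F} from ⟨hF, h⟩) (by simp [hS])
  · obtain ⟨H, ⟨hHD, hGH⟩, hmin⟩ := Set.exists_min_image _ Set.ncard (Set.toFinite _) hS
    have hne : ¬ H ⊆ G := fun h => hG (subset_antisymm hGH h ▸ hHD)
    obtain ⟨b, hbH, hbG⟩ := Set.not_subset.1 hne
    have hsb : star b ∉ H := admissible_iff.1 (hC.admissible H (hDC H hHD)) b hbH
    refine ⟨coord a - coord b, ?_, fun F hF => ?_, ?_⟩
    · intro x hx
      obtain ⟨p, hp⟩ := coord_integer a hx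
      obtain ⟨q, hq⟩ := coord_integer b hx
      exact ⟨p - q, by simp [hp, hq]⟩
    · rw [LinearMap.sub_apply]
      rcases hC.chain.total (hDC F hF) hGC with h | h
      · rw [coord_signedVec_of_notMem (ha F hF h) (hsa F hF h),
          coord_signedVec_of_notMem (fun hb => hbG (h hb)) (fun hb => hsb (hGH (h hb))), sub_zero]
      · have hHF : H ⊆ F := by
          rcases hC.chain.total (hDC F hF) (hDC H hHD) with h' | h'
          · exact (Set.eq_of_subset_of_ncard_le h' (hmin F ⟨hF, h⟩) (Set.toFinite _)).ge
          · exact h'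
        have hadm := hC.admissible F (hDC F hF)
        rw [coord_signedVec_of_mem hadm (h haG), coord_signedVec_of_mem hadm (hHF hbH), sub_self]
    · rw [LinearMap.sub_apply, coord_signedVec_of_mem (hC.admissible G hGC) haG,
        coord_signedVec_of_notMem hbG (fun hb => hsb (hGH hb)), sub_zero]

lemma span_flagCone {n : ℕ} (C : Set (Set (Ground n))) :
    Submodule.span ℝ (flagCone C : Set (Fin n → ℝ)) = Submodule.span ℝ (signedVec '' C) :=
  Submodule.span_span_of_tower _ _ _

lemma linearMap_eq_zero_of_mem_span {n : ℕ} {D : Set (Set (Ground n))}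
    {f : (Fin n → ℝ) →ₗ[ℝ] ℝ} (hf : ∀ F ∈ D, f (signedVec F) = 0) {x : Fin n → ℝ}
    (hx : x ∈ Submodule.span ℝ (signedVec '' D)) : f x = 0 := by
  have : Submodule.span ℝ (signedVec '' D) ≤ LinearMap.ker f := by
    rw [Submodule.span_le]
    rintro _ ⟨F, hF, rfl⟩
    exact hf F hF
  exact this hx

lemma linearMap_nonneg_of_mem_flagCone {n : ℕ} {C : Set (Set (Ground n))}
    {f : (Fin n → ℝ) →ₗ[ℝ] ℝ} (hf : ∀ F ∈ C, 0 ≤ f (signedVec F)) {x : Fin n → ℝ}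
    (hx : x ∈ flagCone C) : 0 ≤ f x := by
  induction hx using Submodule.span_induction with
  | mem x hx =>
    obtain ⟨F, hF, rfl⟩ := hx
    exact hf F hF
  | zero => simp
  | add x y _ _ hx hy => rw [map_add]; exact add_nonneg hx hy
  | smul r x _ hx =>
    rw [show r • x = (r : ℝ) • x from rfl, map_smul]
    exact mul_nonneg r.2 hx

lemma signedVec_mem_flagCone {n : ℕ} {C : Set (Set (Ground n))} {F : Set (Ground n)}
    (hF : F ∈ C) : signedVec F ∈ flagCone C :=
  Submodule.subset_span ⟨F, hF, rfl⟩

lemma linearIndependent_signedVec {n d : ℕ} {C : Set (Set (Ground n))} (hC : IsFlag d C) :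
    LinearIndependent ℝ (fun F : C => signedVec F.1) := by
  classical
  rw [linearIndependent_iff']
  intro s g hg G hGs
  have hins : insert G.1 (C \ {G.1}) = C := by simp
  obtain ⟨f, -, hf0, hf1⟩ := exists_separating_functional (D := C \ {G.1}) (G := G.1)
    (by rwa [hins]) (by simp)
  have h := congrArg f hg
  rw [map_sum, map_zero, Finset.sum_eq_single G] at h
  · simpa [hf1] using h
  · intro F _ hFG
    rw [map_smul, hf0 F.1 ⟨F.2, fun h => hFG (Subtype.ext h)⟩, smul_zero]
  · exact fun h => absurd hGs h

lemma coneDim_flagCone {n d : ℕ} {C : Set (Set (Ground n))} (hC : IsFlag d C) :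
    coneDim (flagCone C) = C.ncard := by
  classical
  have := Fintype.ofFinite C
  have h := finrank_span_eq_card (linearIndependent_signedVec hC)
  rw [coneDim, span_flagCone, Set.image_eq_range, h, ← Nat.card_eq_fintype_card,
    Nat.card_coe_set_eq]

/-- A cone thus determines its flag. Linear inequalities valid on the generators hold at `signedVec
G`: they show that `G` is covered by `C`, and that `G` contains `b` along with `a` whenever every
member of `C` containing `a` contains `b`. -/
lemma mem_of_signedVec_mem_flagCone {n d : ℕ} {C : Set (Set (Ground n))} (hC : IsFlag d C)
    {G : Set (Ground n)} (hG : Admissible G) (hne : G.Nonempty)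
    (h : signedVec G ∈ flagCone C) : G ∈ C := by
  have hcover : ∀ a ∈ G, ∃ F ∈ C, a ∈ F := by
    intro a ha
    by_contra! hcon
    have h1 := linearMap_nonneg_of_mem_flagCone (f := -coord a)
      (fun F hF => by simpa using coord_signedVec_le_zero (hcon F hF)) h
    rw [LinearMap.neg_apply, coord_signedVec_of_mem hG ha] at h1
    linarith
  have hup : ∀ a ∈ G, ∀ b, (∀ F ∈ C, a ∈ F → b ∈ F) → b ∈ G := by
    intro a ha b hb
    obtain ⟨F₀, hF₀, haF₀⟩ := hcover a ha
    have hbF₀ := hb F₀ hF₀ haF₀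
    have h1 := linearMap_nonneg_of_mem_flagCone (f := coord b - coord a) (fun F hF => by
      have hsb : star b ∉ F := by
        intro hs
        rcases hC.chain.total hF hF₀ with h' | h'
        · exact admissible_iff.1 (hC.admissible _ hF₀) b hbF₀ (h' hs)
        · exact admissible_iff.1 (hC.admissible _ hF) b (h' hbF₀) hs
      rw [LinearMap.sub_apply, sub_nonneg]
      by_cases haF : a ∈ F
      · rw [coord_signedVec_of_mem (hC.admissible F hF) haF,
          coord_signedVec_of_mem (hC.admissible F hF) (hb F hF haF)]
      · refine (coord_signedVec_le_zero haF).trans ?_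
        rw [coord_signedVec, if_neg hsb, sub_zero]
        split_ifs <;> norm_num) h
    rw [LinearMap.sub_apply, coord_signedVec_of_mem hG ha, sub_nonneg] at h1
    exact mem_of_one_le_coord h1
  -- Among the elements of `G`, `a` enters the flag last, and `F₀` is the member where it enters.
  obtain ⟨a, ha, hamin⟩ := Set.exists_min_image G (fun a => {F ∈ C | a ∈ F}.ncard)
    (Set.toFinite _) hne
  obtain ⟨F₀, ⟨hF₀, haF₀⟩, hmin⟩ := Set.exists_min_image {F ∈ C | a ∈ F} Set.ncard
    (Set.toFinite _) (hcover a ha)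
  suffices G = F₀ from this ▸ hF₀
  apply subset_antisymm
  · intro b hb
    by_contra hbF₀
    refine absurd (hamin b hb) (not_le.2 (Set.ncard_lt_ncard ⟨?_, fun hcon => ?_⟩ (Set.toFinite _)))
    · rintro F ⟨hF, hbF⟩
      refine ⟨hF, ?_⟩
      rcases hC.chain.total hF hF₀ with h' | h'
      · exact absurd (h' hbF) hbF₀
      · exact h' haF₀
    · exact hbF₀ (hcon ⟨hF₀, haF₀⟩).2
  · intro b hb
    refine hup a ha b fun F hF haF => ?_
    rcases hC.chain.total hF hF₀ with h' | h'
    · exact (Set.eq_of_subset_of_ncard_le h' (hmin F ⟨hF, haF⟩) (Set.toFinite _)) ▸ hb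
    · exact h' hb

lemma flagCone_le_iff {n d : ℕ} {C D : Set (Set (Ground n))} (hC : IsFlag d C)
    (hD : IsFlag d D) : flagCone D ≤ flagCone C ↔ D ⊆ C := by
  constructor
  · intro h F hF
    exact mem_of_signedVec_mem_flagCone hC (hD.admissible F hF) (hD.nonempty F hF)
      (h (signedVec_mem_flagCone hF))
  · intro h
    exact Submodule.span_mono (Set.image_mono h)

lemma flagCone_inj {n d : ℕ} {C D : Set (Set (Ground n))} (hC : IsFlag d C)
    (hD : IsFlag d D) : flagCone C = flagCone D ↔ C = D := by
  constructor
  · intro h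
    exact subset_antisymm ((flagCone_le_iff hD hC).1 h.le) ((flagCone_le_iff hC hD).1 h.ge)
  · rintro rfl
    rfl

/-! ### Normal vectors of flag cones -/

lemma mem_coneLattice_flagCone {n : ℕ} {C : Set (Set (Ground n))} {x : Fin n → ℝ} :
    x ∈ coneLattice (flagCone C) ↔
      x ∈ integerLattice n ∧ x ∈ Submodule.span ℝ (signedVec '' C) := by
  rw [coneLattice, span_flagCone]
  rfl

/-- The integral separating functional forces the `signedVec G`-coefficient of a lattice point to be
an integer. -/
lemma isNormalVector_signedVec {n d : ℕ} {D : Set (Set (Ground n))} {G : Set (Ground n)}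
    (hC : IsFlag d (insert G D)) (hG : G ∉ D) :
    IsNormalVector (flagCone D) (flagCone (insert G D)) (signedVec G) := by
  refine ⟨signedVec_mem_flagCone (Set.mem_insert _ _), le_antisymm ?_ ?_⟩
  · intro x hx
    rw [mem_coneLattice_flagCone, Set.image_insert_eq, Submodule.mem_span_insert] at hx
    obtain ⟨hxZ, r, y, hy, hxy⟩ := hx
    obtain ⟨f, hfZ, hf0, hf1⟩ := exists_separating_functional hC hG
    obtain ⟨m, hm⟩ := hfZ x hxZ
    have hr : r = m := by
      rw [← hm, hxy, map_add, map_smul, hf1, linearMap_eq_zero_of_mem_span hf0 hy]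
      simp
    have hmG : m • signedVec G ∈ integerLattice n :=
      (integerLattice n).zsmul_mem (signedVec_mem_integerLattice G) m
    have hxy' : x = y + m • signedVec G := by
      rw [hxy, hr, add_comm, Int.cast_smul_eq_zsmul]
    rw [AddSubgroup.mem_sup]
    refine ⟨y, mem_coneLattice_flagCone.2 ⟨?_, hy⟩, m • signedVec G, ⟨m, rfl⟩, hxy'.symm⟩
    rw [show y = x - m • signedVec G by rw [hxy']; abel]
    exact (integerLattice n).sub_mem hxZ hmG
  · rw [sup_le_iff]
    constructor
    · intro x hx
      rw [mem_coneLattice_flagCone] at *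
      exact ⟨hx.1, Submodule.span_mono (Set.image_mono (Set.subset_insert _ _)) hx.2⟩
    · rw [AddSubgroup.zmultiples_le, mem_coneLattice_flagCone]
      exact ⟨signedVec_mem_integerLattice G,
        Submodule.subset_span (Set.mem_image_of_mem _ (Set.mem_insert _ _))⟩

/-- The separating functional takes a unit value at a generator of the quotient lattice and is
nonnegative on the cone, so the value is `1`, as at `signedVec G`. -/
lemma IsNormalVector.sub_mem_span {n d : ℕ} {D : Set (Set (Ground n))} {G : Set (Ground n)}
    {u : Fin n → ℝ} (hC : IsFlag d (insert G D)) (hG : G ∉ D)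
    (hu : IsNormalVector (flagCone D) (flagCone (insert G D)) u) :
    u - signedVec G ∈ Submodule.span ℝ (signedVec '' D) := by
  obtain ⟨f, hfZ, hf0, hf1⟩ := exists_separating_functional hC hG
  have huL : u ∈ coneLattice (flagCone (insert G D)) := by
    rw [hu.2]
    exact AddSubgroup.mem_sup_right (AddSubgroup.mem_zmultiples u)
  have hnonneg : 0 ≤ f u := linearMap_nonneg_of_mem_flagCone (by
    intro F hF
    rcases hF with rfl | hF
    · simp [hf1]
    · simp [hf0 F hF]) hu.1
  have hGL : signedVec G ∈ coneLattice (flagCone (insert G D)) :=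
    mem_coneLattice_flagCone.2 ⟨signedVec_mem_integerLattice G,
      Submodule.subset_span (Set.mem_image_of_mem _ (Set.mem_insert _ _))⟩
  rw [hu.2, AddSubgroup.mem_sup] at hGL
  obtain ⟨t, ht, _, ⟨j, rfl⟩, htj⟩ := hGL
  rw [mem_coneLattice_flagCone, Set.image_insert_eq, Submodule.mem_span_insert] at huL
  obtain ⟨huZ, r, y, hy, huy⟩ := huL
  obtain ⟨m, hm⟩ := hfZ u huZ
  have hr : r = f u := by
    rw [huy, map_add, map_smul, hf1, linearMap_eq_zero_of_mem_span hf0 hy]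
    simp
  have hjm : (j : ℝ) * m = 1 := by
    have h := congrArg f (show t + j • u = signedVec G from htj)
    rwa [map_add, linearMap_eq_zero_of_mem_span hf0 (mem_coneLattice_flagCone.1 ht).2, zero_add,
      map_zsmul, hm, hf1, zsmul_eq_mul] at h
  have hm1 : m = 1 := by
    rw [hm] at hnonneg
    have hm0 : 0 ≤ m := by exact_mod_cast hnonneg
    rcases Int.isUnit_iff.1 (IsUnit.of_mul_eq_one j
      (show m * j = 1 by rw [mul_comm]; exact_mod_cast hjm)) with h | h
    · exact h
    · omega
  have : u - signedVec G = y := by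
    rw [hm, hm1] at hr
    rw [huy, hr]
    simp
  rwa [this]

/-! ### The balancing condition in terms of flags -/

open Classical in
/-- The weight of the cone of a flag, with value `0` if this is not a cone of dimension `d`. -/
noncomputable def flagWeight {n d : ℕ} {Δ : Set (PointedCone ℝ (Fin n → ℝ))}
    (c : conesOfDim Δ d → ℤ) (C : Set (Set (Ground n))) : ℤ :=
  if h : flagCone C ∈ conesOfDim Δ d then c ⟨flagCone C, h⟩ else 0

/-- The sets that can be added to a flag. -/
def flagExtensions {n : ℕ} (d : ℕ) (D : Set (Set (Ground n))) : Set (Set (Ground n)) :=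
  {G | G ∉ D ∧ IsFlag d (insert G D)}

/-- A fan consisting of the cones of flags of admissible sets with at most `d` elements. -/
def IsFlagFan {n : ℕ} (d : ℕ) (Δ : Set (PointedCone ℝ (Fin n → ℝ))) : Prop :=
  ∀ σ, σ ∈ Δ ↔ ∃ C : Set (Set (Ground n)), IsFlag d C ∧ σ = flagCone C

lemma IsFlagFan.mem_conesOfDim_iff {n d e : ℕ} {Δ : Set (PointedCone ℝ (Fin n → ℝ))}
    (hΔ : IsFlagFan d Δ) {σ : PointedCone ℝ (Fin n → ℝ)} : σ ∈ conesOfDim Δ e ↔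
      ∃ C : Set (Set (Ground n)), IsFlag d C ∧ C.ncard = e ∧ σ = flagCone C := by
  constructor
  · rintro ⟨h, hd⟩
    obtain ⟨C, hC, rfl⟩ := (hΔ σ).1 h
    exact ⟨C, hC, by rw [← hd, coneDim_flagCone hC], rfl⟩
  · rintro ⟨C, hC, hd, rfl⟩
    exact ⟨(hΔ _).2 ⟨C, hC, rfl⟩, by rw [← hd, coneDim_flagCone hC]⟩

lemma IsFlagFan.flagCone_insert_mem {n d : ℕ} {Δ : Set (PointedCone ℝ (Fin n → ℝ))}
    (hΔ : IsFlagFan d Δ) {D : Set (Set (Ground n))} (hDd : D.ncard + 1 = d)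
    {G : Set (Ground n)} (hG : G ∈ flagExtensions d D) :
    flagCone (insert G D) ∈ conesOfDim Δ d :=
  hΔ.mem_conesOfDim_iff.2 ⟨_, hG.2, by rw [Set.ncard_insert_of_notMem hG.1, hDd], rfl⟩

/-- Cones of dimension `d` over `flagCone D` correspond to one-set extensions of `D`, and each
normal vector may be replaced by `signedVec G` modulo the span. -/
lemma sum_normal_mem_iff {n d : ℕ} {Δ : Set (PointedCone ℝ (Fin n → ℝ))}
    (hΔ : IsFlagFan d Δ) (c : conesOfDim Δ d → ℤ) {D : Set (Set (Ground n))}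
    (hD : IsFlag d D) (hDd : D.ncard + 1 = d) (u : conesOfDim Δ d → (Fin n → ℝ))
    (hu : ∀ σ : conesOfDim Δ d, flagCone D ≤ σ.1 → IsNormalVector (flagCone D) σ.1 (u σ)) :
    ∑ᶠ (σ : conesOfDim Δ d) (_ : flagCone D ≤ σ.1), c σ • u σ ∈
        Submodule.span ℝ (signedVec '' D) ↔
      ∑ᶠ G : flagExtensions d D, flagWeight c (insert G.1 D) • signedVec G.1 ∈
        Submodule.span ℝ (signedVec '' D) := by
  classical
  have key : ∑ᶠ (σ : conesOfDim Δ d) (_ : flagCone D ≤ σ.1), c σ • u σ =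
      ∑ᶠ G : flagExtensions d D, flagWeight c (insert G.1 D) •
        u ⟨_, hΔ.flagCone_insert_mem hDd G.2⟩ := by
    rw [show ∑ᶠ (σ : conesOfDim Δ d) (_ : flagCone D ≤ σ.1), c σ • u σ =
      ∑ᶠ (σ : conesOfDim Δ d) (_ : σ ∈ {σ : conesOfDim Δ d | flagCone D ≤ σ.1}), c σ • u σ from rfl,
      ← finsum_set_coe_eq_finsum_mem]
    symm
    refine finsum_eq_of_bijective (fun G => ⟨⟨_, hΔ.flagCone_insert_mem hDd G.2⟩,
      Submodule.span_mono (Set.image_mono (Set.subset_insert _ _))⟩) ⟨?_, ?_⟩ ?_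
    · intro G G' h
      have h' : flagCone (insert G.1 D) = flagCone (insert G'.1 D) :=
        congrArg (fun x => x.1.1) h
      rw [flagCone_inj G.2.2 G'.2.2] at h'
      have hm : G.1 ∈ insert G'.1 D := h' ▸ Set.mem_insert _ _
      rcases hm with hm | hm
      · exact Subtype.ext hm
      · exact absurd hm G.2.1
    · rintro ⟨⟨σ, hσ⟩, hle⟩
      obtain ⟨C, hC, hCd, rfl⟩ := hΔ.mem_conesOfDim_iff.1 hσ
      have hDC : D ⊆ C := (flagCone_le_iff hC hD).1 hle
      obtain ⟨G, hG⟩ : ∃ G, C \ D = {G} := by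
        rw [← Set.ncard_eq_one, Set.ncard_sdiff hDC]
        omega
      have hGCD : G ∈ C \ D := by simp [hG]
      have hins : insert G D = C := by
        rw [← Set.singleton_union, ← hG, Set.sdiff_union_of_subset hDC]
      refine ⟨⟨G, hGCD.2, hins ▸ hC⟩, ?_⟩
      exact Subtype.ext (Subtype.ext (congrArg flagCone hins))
    · intro G
      simp [flagWeight, hΔ.flagCone_insert_mem hDd G.2]
  have := Fintype.ofFinite (flagExtensions d D)
  rw [key, finsum_eq_sum_of_fintype, finsum_eq_sum_of_fintype]
  have hdiff : ∑ G : flagExtensions d D, (flagWeight c (insert G.1 D) •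
        u ⟨_, hΔ.flagCone_insert_mem hDd G.2⟩ - flagWeight c (insert G.1 D) • signedVec G.1) ∈
      Submodule.span ℝ (signedVec '' D) := by
    refine Submodule.sum_mem _ fun G _ => ?_
    rw [← smul_sub]
    exact zsmul_mem (IsNormalVector.sub_mem_span G.2.2 G.2.1
      (hu ⟨_, hΔ.flagCone_insert_mem hDd G.2⟩
        (Submodule.span_mono (Set.image_mono (Set.subset_insert _ _))))) _
  rw [Finset.sum_sub_distrib] at hdiff
  constructor
  · intro h
    exact (Submodule.sub_mem_iff_right _ h).1 hdiff
  · intro h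
    exact (Submodule.sub_mem_iff_left _ h).1 hdiff

lemma isBalanced_iff {n d : ℕ} {Δ : Set (PointedCone ℝ (Fin n → ℝ))}
    (hΔ : IsFlagFan d Δ) (c : conesOfDim Δ d → ℤ) :
    IsBalanced Δ d c ↔ ∀ D : Set (Set (Ground n)), IsFlag d D → D.ncard + 1 = d →
      ∑ᶠ G : flagExtensions d D, flagWeight c (insert G.1 D) • signedVec G.1 ∈
        Submodule.span ℝ (signedVec '' D) := by
  classical
  constructor
  · intro h D hD hDd
    -- `IsBalanced` quantifies over choices of normal vectors, so using it requires that a choice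
    -- exists.
    have hex : ∀ σ : conesOfDim Δ d, flagCone D ≤ σ.1 →
        ∃ u, IsNormalVector (flagCone D) σ.1 u := by
      rintro ⟨σ, hσ⟩ hle
      obtain ⟨C, hC, hCd, rfl⟩ := hΔ.mem_conesOfDim_iff.1 hσ
      have hDC : D ⊆ C := (flagCone_le_iff hC hD).1 hle
      obtain ⟨G, hG⟩ : ∃ G, C \ D = {G} := by
        rw [← Set.ncard_eq_one, Set.ncard_sdiff hDC]
        omega
      have hGCD : G ∈ C \ D := by simp [hG]
      have hins : insert G D = C := by
        rw [← Set.singleton_union, ← hG, Set.sdiff_union_of_subset hDC]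
      refine ⟨signedVec G, ?_⟩
      have := isNormalVector_signedVec (hins ▸ hC) hGCD.2
      rwa [hins] at this
    choose! u hu using hex
    rw [← sum_normal_mem_iff hΔ c hD hDd u hu, ← span_flagCone]
    exact h _ ((hΔ _).2 ⟨D, hD, rfl⟩) (by rw [coneDim_flagCone hD, hDd]) u hu
  · intro h τ hτ hd u hu
    obtain ⟨D, hD, rfl⟩ := (hΔ τ).1 hτ
    rw [coneDim_flagCone hD] at hd
    rw [span_flagCone, sum_normal_mem_iff hΔ c hD hd u hu]
    exact h D hD hd

/-! ### Complete flags as lists -/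

/-- The set of entries of a list. -/
def listSet {n : ℕ} (l : List (Ground n)) : Set (Ground n) := {x | x ∈ l}

@[simp] lemma mem_listSet {n : ℕ} {l : List (Ground n)} {x : Ground n} :
    x ∈ listSet l ↔ x ∈ l := Iff.rfl

lemma ncard_listSet {n : ℕ} {l : List (Ground n)} (hl : l.Nodup) :
    (listSet l).ncard = l.length := by
  classical
  rw [← List.toFinset_card_of_nodup hl, ← Set.ncard_coe_finset, List.coe_toFinset]
  rfl

lemma admissible_listSet {n : ℕ} {l : List (Ground n)} (hl : (l.map index).Nodup) :
    Admissible (listSet l) :=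
  admissible_iff_injOn.2 fun _ hx _ hy h => List.inj_on_of_nodup_map hl hx hy h

/-- The flag formed by the sets of entries of the nonempty suffixes of a list. -/
def listFlag {n : ℕ} : List (Ground n) → Set (Set (Ground n))
  | [] => ∅
  | a :: l => insert (listSet (a :: l)) (listFlag l)

/-- The sets of entries of the suffixes of `p ++ q` that are longer than `q`. -/
def listFlagOver {n : ℕ} (q : List (Ground n)) : List (Ground n) → Set (Set (Ground n))
  | [] => ∅
  | a :: p => insert (listSet (a :: p ++ q)) (listFlagOver q p)

lemma listFlag_append {n : ℕ} (p q : List (Ground n)) :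
    listFlag (p ++ q) = listFlagOver q p ∪ listFlag q := by
  induction p with
  | nil => simp [listFlagOver]
  | cons a p ih => simp [listFlagOver, listFlag, ih, Set.insert_union]

/-- The longer suffixes do not see the order of `q`; hence swapping adjacent entries changes only
one member of a flag. -/
lemma listFlagOver_congr {n : ℕ} {q q' : List (Ground n)} (h : ∀ x, x ∈ q ↔ x ∈ q')
    (p : List (Ground n)) : listFlagOver q p = listFlagOver q' p := by
  induction p with
  | nil => rfl
  | cons a p ih =>
    rw [listFlagOver, listFlagOver, ih]
    congr 1
    ext x
    simp [h]

lemma subset_of_mem_listFlag {n : ℕ} {l : List (Ground n)} {F : Set (Ground n)}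
    (hF : F ∈ listFlag l) : F ⊆ listSet l := by
  induction l with
  | nil => exact absurd hF (Set.notMem_empty _)
  | cons a l ih =>
    rcases hF with rfl | hF
    · exact le_rfl
    · exact fun x hx => List.mem_cons_of_mem _ (ih hF hx)

lemma listSet_mem_listFlag {n : ℕ} {l : List (Ground n)} (hl : l ≠ []) :
    listSet l ∈ listFlag l := by
  cases l with
  | nil => exact absurd rfl hl
  | cons a l => exact Set.mem_insert _ _

lemma signedVec_listSet_mem_span {n : ℕ} (l : List (Ground n)) :
    signedVec (listSet l) ∈ Submodule.span ℝ (signedVec '' listFlag l) := by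
  by_cases hl : l = []
  · subst hl
    have : signedVec (listSet ([] : List (Ground n))) = 0 := by
      simp [signedVec]
    rw [this]
    exact Submodule.zero_mem _
  · exact Submodule.subset_span (Set.mem_image_of_mem _ (listSet_mem_listFlag hl))

lemma exists_eq_append_of_mem_listFlag {n : ℕ} {l : List (Ground n)} {F : Set (Ground n)}
    (hF : F ∈ listFlag l) : ∃ p a q, l = p ++ a :: q ∧ F = listSet (a :: q) := by
  induction l with
  | nil => exact absurd hF (Set.notMem_empty _)
  | cons b l ih =>
    rcases hF with rfl | hF
    · exact ⟨[], b, l, rfl, rfl⟩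
    · obtain ⟨p, a, q, rfl, rfl⟩ := ih hF
      exact ⟨b :: p, a, q, rfl, rfl⟩

lemma exists_mem_of_mem_listFlagOver {n : ℕ} {p q : List (Ground n)} {F : Set (Ground n)}
    (hF : F ∈ listFlagOver q p) : ∃ x ∈ p, x ∈ F := by
  induction p with
  | nil => exact absurd hF (Set.notMem_empty _)
  | cons b p ih =>
    rcases hF with rfl | hF
    · exact ⟨b, by simp⟩
    · obtain ⟨x, hx, hxF⟩ := ih hF
      exact ⟨x, List.mem_cons_of_mem _ hx, hxF⟩

lemma notMem_of_nodup_index_cons {n : ℕ} {a : Ground n} {l : List (Ground n)}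
    (hl : ((a :: l).map index).Nodup) : a ∉ l ∧ star a ∉ l := by
  rw [List.map_cons, List.nodup_cons] at hl
  exact ⟨fun h => hl.1 (List.mem_map_of_mem h),
    fun h => hl.1 (by simpa using List.mem_map_of_mem (f := index) h)⟩

lemma isFlag_listFlag {n d : ℕ} {l : List (Ground n)} (hl : (l.map index).Nodup)
    (hd : l.length ≤ d) : IsFlag d (listFlag l) := by
  induction l with
  | nil =>
    constructor
    · simp [listFlag]
    · simp [listFlag]
    · simp [listFlag]
    · exact IsChain.empty
  | cons a l ih =>
    have ih' := ih (List.nodup_cons.1 hl).2 ((Nat.le_succ _).trans hd)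
    constructor
    · rintro F (rfl | hF)
      · exact admissible_listSet hl
      · exact ih'.admissible F hF
    · rintro F (rfl | hF)
      · exact ⟨a, by simp⟩
      · exact ih'.nonempty F hF
    · rintro F (rfl | hF)
      · rwa [ncard_listSet hl.of_map]
      · exact ih'.ncard_le F hF
    · refine ih'.chain.insert fun F hF _ => Or.inr ?_
      exact fun x hx => List.mem_cons_of_mem _ (subset_of_mem_listFlag hF hx)

lemma ncard_listFlag {n : ℕ} {l : List (Ground n)} (hl : (l.map index).Nodup) :
    (listFlag l).ncard = l.length := by
  induction l with
  | nil => simp [listFlag]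
  | cons a l ih =>
    rw [listFlag, Set.ncard_insert_of_notMem _ (Set.toFinite _), ih (List.nodup_cons.1 hl).2,
      List.length_cons]
    intro h
    exact (notMem_of_nodup_index_cons hl).1
      (subset_of_mem_listFlag h (List.mem_cons_self : a ∈ a :: l))

/-- The `d` members have distinct sizes between `1` and `d`, so every size occurs. -/
lemma IsFlag.exists_ncard_eq {n d : ℕ} {C : Set (Set (Ground n))} (hC : IsFlag d C)
    (hd : C.ncard = d) {j : ℕ} (hj : 1 ≤ j) (hjd : j ≤ d) : ∃ F ∈ C, F.ncard = j := by
  have himage : (Set.ncard '' C).ncard = d := by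
    rw [Set.InjOn.ncard_image, hd]
    exact fun F hF G hG h => hC.eq_of_ncard_eq hF hG h
  have hsub : Set.ncard '' C ⊆ Set.Icc 1 d := by
    rintro _ ⟨F, hF, rfl⟩
    exact ⟨(Set.ncard_pos (Set.toFinite _)).2 (hC.nonempty F hF), hC.ncard_le F hF⟩
  have := Set.eq_of_subset_of_ncard_le hsub
    (by rw [himage, Set.ncard_eq_toFinset_card']; simp) (Set.toFinite _)
  have hmem : j ∈ Set.ncard '' C := this ▸ ⟨hj, hjd⟩
  exact hmem

/-- Peel off the member of size `d`: the single element it adds to the rest becomes the head of the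
list. -/
lemma IsFlag.exists_eq_listFlag {n d : ℕ} {C : Set (Set (Ground n))} (hC : IsFlag d C)
    (hd : C.ncard = d) : ∃ l : List (Ground n), (l.map index).Nodup ∧ l.length = d ∧
      C = listFlag l := by
  induction d generalizing C with
  | zero =>
    refine ⟨[], by simp, rfl, ?_⟩
    rwa [Set.ncard_eq_zero (Set.toFinite _)] at hd
  | succ d ih =>
    obtain ⟨T, hT, hTd⟩ := hC.exists_ncard_eq hd (Nat.le_add_left 1 d) le_rfl
    have hins : insert T (C \ {T}) = C := by simp [Set.insert_eq_of_mem hT]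
    have hsub := hC.mono (D := C \ {T}) Set.sdiff_subset
    have hcard : (C \ {T}).ncard = d := by
      have := Set.ncard_sdiff_singleton_add_one hT (Set.toFinite _)
      omega
    obtain ⟨l, hl, hld, hCl⟩ := ih (C := C \ {T}) ⟨hsub.admissible, hsub.nonempty, fun F hF => by
      have h1 := hC.ncard_le F hF.1
      have h2 : F.ncard ≠ d + 1 := fun h => hF.2 (hC.eq_of_ncard_eq hF.1 hT (h.trans hTd.symm))
      omega, hsub.chain⟩ hcard
    have hlcard := ncard_listSet hl.of_map
    have hlT : listSet l ⊆ T := by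
      by_cases hnil : l = []
      · subst hnil
        intro x hx
        simp at hx
      · have hlC : listSet l ∈ C := by
          rw [← hins, hCl]
          exact Set.mem_insert_of_mem _ (listSet_mem_listFlag hnil)
        rcases hC.chain.total hlC hT with h | h
        · exact h
        · have := Set.ncard_le_ncard h (Set.toFinite _)
          omega
    obtain ⟨a, ha⟩ : ∃ a, T \ listSet l = {a} := by
      rw [← Set.ncard_eq_one, Set.ncard_sdiff hlT]
      omega
    have haT : a ∈ T \ listSet l := by simp [ha]
    have hTa : T = listSet (a :: l) := by
      rw [← Set.sdiff_union_of_subset hlT, ha]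
      ext x
      simp
    refine ⟨a :: l, ?_, by simp [hld], ?_⟩
    · rw [List.map_cons, List.nodup_cons]
      refine ⟨fun h => ?_, hl⟩
      obtain ⟨b, hb, hba⟩ := List.mem_map.1 h
      have := admissible_iff_injOn.1 (hC.admissible T hT) (hlT hb) haT.1 hba
      exact haT.2 (this ▸ hb)
    · rw [listFlag, ← hTa, ← hCl, hins]

/-! ### Opposite extensions of a flag -/

lemma signedVec_listSet_cons {n : ℕ} {a : Ground n} {l : List (Ground n)} (h : a ∉ l) :
    signedVec (listSet (a :: l)) = signedUnit a + signedVec (listSet l) := by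
  classical
  unfold signedVec
  rw [← Finset.sum_insert (by simpa using h)]
  refine Finset.sum_congr ?_ fun _ _ => rfl
  ext x
  simp

lemma signedUnit_star {n : ℕ} (a : Ground n) : signedUnit (star a) = -signedUnit a := by
  cases a <;> simp [signedUnit, star]

/-- The two unit vectors cancel, leaving twice the vector of `q`. -/
lemma signedVec_cons_add_star_cons {n : ℕ} {a : Ground n} {q : List (Ground n)}
    (hl : ((a :: q).map index).Nodup) :
    signedVec (listSet (a :: q)) + signedVec (listSet (star a :: q)) ∈
      Submodule.span ℝ (signedVec '' listFlag q) := by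
  have h := notMem_of_nodup_index_cons hl
  rw [signedVec_listSet_cons h.1, signedVec_listSet_cons h.2, signedUnit_star]
  have h2 := signedVec_listSet_mem_span q
  convert Submodule.add_mem _ h2 h2 using 1
  abel

/-- The flag of the list `p ++ b :: a :: q` without the set of entries of `a :: q`. -/
def swapFlag {n : ℕ} (p : List (Ground n)) (b a : Ground n) (q : List (Ground n)) :
    Set (Set (Ground n)) :=
  listFlagOver (b :: a :: q) p ∪ insert (listSet (b :: a :: q)) (listFlag q)

lemma swapFlag_comm {n : ℕ} (p : List (Ground n)) (b a : Ground n) (q : List (Ground n)) :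
    swapFlag p b a q = swapFlag p a b q := by
  have h : listSet (b :: a :: q) = listSet (a :: b :: q) := by
    ext x
    simp only [mem_listSet, List.mem_cons]
    tauto
  rw [swapFlag, swapFlag, h, listFlagOver_congr (q := b :: a :: q) (q' := a :: b :: q)]
  intro x
  simp only [List.mem_cons]
  tauto

lemma insert_swapFlag {n : ℕ} (p : List (Ground n)) (b a : Ground n) (q : List (Ground n)) :
    insert (listSet (a :: q)) (swapFlag p b a q) = listFlag (p ++ b :: a :: q) := by
  rw [listFlag_append, swapFlag, listFlag, listFlag]
  ext F
  simp only [Set.mem_insert_iff, Set.mem_union]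
  tauto

lemma listSet_notMem_listFlag {n : ℕ} {a : Ground n} {q : List (Ground n)} (h : a ∉ q) :
    listSet (a :: q) ∉ listFlag q :=
  fun hm => h (subset_of_mem_listFlag hm (List.mem_cons_self : a ∈ a :: q))

lemma listSet_notMem_swapFlag {n : ℕ} {p q : List (Ground n)} {a b : Ground n}
    (hl : (p ++ b :: a :: q).Nodup) : listSet (a :: q) ∉ swapFlag p b a q := by
  obtain ⟨-, hnd, hdisj⟩ := List.nodup_append.1 hl
  obtain ⟨hb, haq⟩ := List.nodup_cons.1 hnd
  rintro (h | h | h)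
  · obtain ⟨x, hx, hxa⟩ := exists_mem_of_mem_listFlagOver h
    exact hdisj x hx x (List.mem_cons_of_mem _ hxa) rfl
  · exact hb (h ▸ (List.mem_cons_self : b ∈ b :: a :: q) : b ∈ listSet (a :: q))
  · exact listSet_notMem_listFlag (List.nodup_cons.1 haq).1 h

lemma nodup_index_swap {n : ℕ} {p q : List (Ground n)} {a b : Ground n}
    (hl : ((p ++ b :: a :: q).map index).Nodup) : ((p ++ a :: b :: q).map index).Nodup :=
  (((List.Perm.swap a b q).append_left p).map index).nodup_iff.1 hl

/-- The sum equals the vector of `q` plus that of `b :: a :: q`, both in the span. -/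
lemma signedVec_swap_mem {n : ℕ} {p q : List (Ground n)} {a b : Ground n}
    (hl : ((p ++ b :: a :: q).map index).Nodup) :
    signedVec (listSet (a :: q)) + signedVec (listSet (b :: q)) ∈
      Submodule.span ℝ (signedVec '' swapFlag p b a q) := by
  have hnd : (b :: a :: q).Nodup := (List.nodup_append.1 hl.of_map).2.1
  rw [List.nodup_cons, List.nodup_cons, List.mem_cons, not_or] at hnd
  have hb := signedVec_listSet_cons (a := b) (l := a :: q)
    (by rw [List.mem_cons, not_or]; exact hnd.1)
  have h1 : signedVec (listSet q) ∈ Submodule.span ℝ (signedVec '' swapFlag p b a q) := by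
    refine Submodule.span_mono (Set.image_mono ?_) (signedVec_listSet_mem_span q)
    exact fun F hF => Or.inr (Or.inr hF)
  have h2 : signedVec (listSet (b :: a :: q)) ∈
      Submodule.span ℝ (signedVec '' swapFlag p b a q) :=
    Submodule.subset_span (Set.mem_image_of_mem _ (Or.inr (Or.inl rfl)))
  convert Submodule.add_mem _ h1 h2 using 1
  rw [hb, signedVec_listSet_cons hnd.1.2, signedVec_listSet_cons hnd.2.1]
  abel

/-- The coordinates occurring in a cone. -/
noncomputable def coneSupport {n : ℕ} (σ : PointedCone ℝ (Fin n → ℝ)) : Finset (Fin n) := by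
  classical exact {i | ∃ x ∈ σ, x i ≠ 0}

lemma coneSupport_flagCone_listFlag {n : ℕ} {l : List (Ground n)} (hl : (l.map index).Nodup) :
    coneSupport (flagCone (listFlag l)) = (l.map index).toFinset := by
  ext i
  simp only [coneSupport, Finset.mem_filter, Finset.mem_univ, true_and, List.mem_toFinset]
  constructor
  · rintro ⟨x, hx, hxi⟩
    by_contra hi
    have hnot : ∀ a : Ground n, index a = i → ∀ F ∈ listFlag l, a ∉ F := fun a ha F hF haF =>
      hi (ha ▸ List.mem_map_of_mem (subset_of_mem_listFlag hF haF))
    have hx' : x ∈ Submodule.span ℝ (signedVec '' listFlag l) := by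
      rw [← span_flagCone]
      exact Submodule.subset_span hx
    exact hxi (linearMap_eq_zero_of_mem_span (f := coord (Sum.inl i)) (fun F hF =>
      coord_signedVec_of_notMem (hnot _ rfl F hF) (hnot _ (index_star _) F hF)) hx')
  · intro hi
    obtain ⟨a, ha, rfl⟩ := List.mem_map.1 hi
    refine ⟨_, signedVec_mem_flagCone (listSet_mem_listFlag (List.ne_nil_of_mem ha)), ?_⟩
    have := coord_signedVec_of_mem (admissible_listSet hl) (show a ∈ listSet l from ha)
    intro h0
    cases a <;> simp_all [coord]

/-- Every extension must supply the one size missing from `D`. -/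
lemma ncard_eq_of_mem_flagExtensions {n d : ℕ} {D : Set (Set (Ground n))}
    (hDd : D.ncard + 1 = d) {G G' : Set (Ground n)} (hG : G ∈ flagExtensions d D)
    (hG' : G' ∈ flagExtensions d D) : G'.ncard = G.ncard := by
  by_contra hne
  obtain ⟨F, hF, hFG⟩ := hG'.2.exists_ncard_eq
    (by rw [Set.ncard_insert_of_notMem hG'.1, hDd]) (j := G.ncard)
    ((Set.ncard_pos (Set.toFinite _)).2 (hG.2.nonempty G (Set.mem_insert _ _)))
    (hG.2.ncard_le G (Set.mem_insert _ _))
  rcases hF with rfl | hF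
  · exact hne hFG
  · have := hG.2.eq_of_ncard_eq (Set.mem_insert_of_mem _ hF) (Set.mem_insert _ _) hFG
    exact hG.1 (this ▸ hF)

lemma listSet_subset_of_mem_flagExtensions {n d : ℕ} {D : Set (Set (Ground n))}
    {q : List (Ground n)} (hqD : listFlag q ⊆ D) {G : Set (Ground n)}
    (hG : G ∈ flagExtensions d D) (hq : q.Nodup) (hcard : q.length < G.ncard) :
    listSet q ⊆ G := by
  by_cases hnil : q = []
  · subst hnil
    intro x hx
    simp at hx
  · rcases hG.2.chain.total (Set.mem_insert_of_mem _ (hqD (listSet_mem_listFlag hnil)))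
      (Set.mem_insert _ _) with h | h
    · exact h
    · have := Set.ncard_le_ncard h (Set.toFinite _)
      rw [ncard_listSet hq] at this
      omega

lemma eq_listSet_cons {n : ℕ} {q : List (Ground n)} {G : Set (Ground n)} {a : Ground n}
    (hqG : listSet q ⊆ G) (haG : a ∈ G) (hnd : (a :: q).Nodup) (hcard : G.ncard = q.length + 1) :
    G = listSet (a :: q) := by
  symm
  refine Set.eq_of_subset_of_ncard_le ?_ ?_ (Set.toFinite _)
  · intro x hx
    rcases List.mem_cons.1 hx with rfl | hx
    · exact haG
    · exact hqG hx
  · rw [ncard_listSet hnd, hcard, List.length_cons]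

/-- Two extensions of a flag are opposite if the vectors that they add sum to an element of the
span of the flag. -/
def IsOpposite {n : ℕ} (D : Set (Set (Ground n))) (G G' : Set (Ground n)) : Prop :=
  signedVec G + signedVec G' ∈ Submodule.span ℝ (signedVec '' D)

lemma notMem_of_isOpposite {n d : ℕ} {D : Set (Set (Ground n))} {G G' : Set (Ground n)}
    (hG : G ∈ flagExtensions d D) (h : IsOpposite D G G') : G' ∉ D := by
  intro hG'
  obtain ⟨f, -, hf0, hf1⟩ := exists_separating_functional hG.2 hG.1
  have := linearMap_eq_zero_of_mem_span hf0 h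
  rw [map_add, hf1, hf0 _ hG'] at this
  norm_num at this

lemma insert_inj_of_notMem {α : Type*} {a : α} {s t : Set α} (h : insert a s = insert a t)
    (hs : a ∉ s) (ht : a ∉ t) : s = t := by
  rw [← Set.insert_sdiff_self_of_notMem hs, h, Set.insert_sdiff_self_of_notMem ht]

/-- If the missing set is the largest one, the opposite extension replaces `a` by `a*`, and `coord
a` kills all extensions by other indices. If it is an intermediate one, the only other extension
swaps `a` and `b`. The functional `f` lets the balancing relation be read off one pair at a time. -/
lemma exists_opposite {n d : ℕ} {D : Set (Set (Ground n))} (hDd : D.ncard + 1 = d)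
    {G : Set (Ground n)} (hG : G ∈ flagExtensions d D) :
    ∃ G' ∈ flagExtensions d D, IsOpposite D G G' ∧
      coneSupport (flagCone (insert G' D)) = coneSupport (flagCone (insert G D)) ∧
      ∃ f : (Fin n → ℝ) →ₗ[ℝ] ℝ, (∀ F ∈ D, f (signedVec F) = 0) ∧ f (signedVec G) = 1 ∧
        ∀ H ∈ flagExtensions d D, H ≠ G → H ≠ G' → f (signedVec H) = 0 := by
  obtain ⟨l, hl, hld, hCl⟩ := hG.2.exists_eq_listFlag
    (by rw [Set.ncard_insert_of_notMem hG.1, hDd])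
  obtain ⟨p, a, q, rfl, rfl⟩ :=
    exists_eq_append_of_mem_listFlag (hCl ▸ Set.mem_insert G D)
  have hcards := fun H hH => ncard_eq_of_mem_flagExtensions hDd hG (G' := H) hH
  have haq : (a :: q).Nodup := (List.nodup_append.1 hl.of_map).2.1
  have hqnd : q.Nodup := (List.nodup_cons.1 haq).2
  rw [ncard_listSet haq, List.length_cons] at hcards
  -- `p` is empty exactly when the missing set is the largest of the flag.
  rcases List.eq_nil_or_concat p with rfl | ⟨p, b, rfl⟩
  · rw [List.nil_append] at hl hCl hld
    have hnot := notMem_of_nodup_index_cons hl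
    have hD : D = listFlag q := by
      refine insert_inj_of_notMem (a := listSet (a :: q)) hCl hG.1 ?_
      exact listSet_notMem_listFlag hnot.1
    subst hD
    have hl' : ((star a :: q).map index).Nodup := by simpa using hl
    have hopp : IsOpposite (listFlag q) (listSet (a :: q)) (listSet (star a :: q)) :=
      signedVec_cons_add_star_cons hl
    have hext : insert (listSet (star a :: q)) (listFlag q) = listFlag (star a :: q) := rfl
    refine ⟨listSet (star a :: q), ⟨notMem_of_isOpposite hG hopp, ?_⟩, hopp, ?_,
      coord a, ?_, ?_, ?_⟩
    · rw [hext]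
      exact isFlag_listFlag hl' (by simpa using hld.le)
    · rw [hext, hCl, coneSupport_flagCone_listFlag hl, coneSupport_flagCone_listFlag hl']
      simp
    · intro F hF
      exact coord_signedVec_of_notMem (fun h => hnot.1 (subset_of_mem_listFlag hF h))
        (fun h => hnot.2 (subset_of_mem_listFlag hF h))
    · exact coord_signedVec_of_mem (admissible_listSet hl) (List.mem_cons_self : a ∈ a :: q)
    · intro H hH h1 h2
      have hqH := listSet_subset_of_mem_flagExtensions le_rfl hH hqnd (by rw [hcards H hH]; omega)
      exact coord_signedVec_of_notMem
        (fun h => h1 (eq_listSet_cons hqH h haq (hcards H hH)))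
        (fun h => h2 (eq_listSet_cons hqH h hl'.of_map (hcards H hH)))
  · rw [List.concat_eq_append, List.append_assoc, List.singleton_append] at hl hCl hld
    have hnd : (b :: a :: q).Nodup := (List.nodup_append.1 hl.of_map).2.1
    have haD : listSet (a :: q) ∉ swapFlag p b a q := listSet_notMem_swapFlag hl.of_map
    have hD : D = swapFlag p b a q :=
      insert_inj_of_notMem (hCl.trans (insert_swapFlag p b a q).symm) hG.1 haD
    subst hD
    have hl' := nodup_index_swap hl
    have hopp : IsOpposite (swapFlag p b a q) (listSet (a :: q)) (listSet (b :: q)) :=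
      signedVec_swap_mem hl
    have hext : insert (listSet (b :: q)) (swapFlag p b a q) = listFlag (p ++ a :: b :: q) := by
      rw [swapFlag_comm, insert_swapFlag]
    obtain ⟨f, -, hf0, hf1⟩ := exists_separating_functional hG.2 hG.1
    refine ⟨listSet (b :: q), ⟨notMem_of_isOpposite hG hopp, ?_⟩, hopp, ?_, f, hf0, hf1, ?_⟩
    · rw [hext]
      exact isFlag_listFlag hl' (by simpa using hld.le)
    · rw [hext, hCl, coneSupport_flagCone_listFlag hl, coneSupport_flagCone_listFlag hl']
      exact List.toFinset_eq_of_perm _ _ (((List.Perm.swap b a q).append_left p).map index)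
    · intro H hH h1 h2
      -- A third extension lies between `q` and `b :: a :: q` and contains neither `a` nor `b`, so
      -- it is too small.
      exfalso
      have hbq : (b :: q).Nodup := hnd.sublist (by simp)
      have hqH := listSet_subset_of_mem_flagExtensions
        (D := swapFlag p b a q) (fun F hF => Or.inr (Or.inr hF)) hH hqnd
        (by rw [hcards H hH]; omega)
      have hHba : H ⊆ listSet (b :: a :: q) := by
        rcases hH.2.chain.total (Set.mem_insert _ _) (Set.mem_insert_of_mem _
          (show listSet (b :: a :: q) ∈ swapFlag p b a q from Or.inr (Or.inl rfl))) with h | h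
        · exact h
        · have := Set.ncard_le_ncard h (Set.toFinite _)
          rw [ncard_listSet hnd, hcards H hH, List.length_cons, List.length_cons] at this
          omega
      have hHq : H ⊆ listSet q := by
        intro x hx
        rcases List.mem_cons.1 (hHba hx) with rfl | hxa
        · exact absurd (eq_listSet_cons hqH hx hbq (hcards H hH)) h2
        rcases List.mem_cons.1 hxa with rfl | hxq
        · exact absurd (eq_listSet_cons hqH hx haq (hcards H hH)) h1
        · exact hxq
      have := Set.ncard_le_ncard hHq (Set.toFinite _)
      rw [ncard_listSet hqnd, hcards H hH] at this
      omega

/-! ### Balanced weights are the weights depending only on the support -/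

lemma flagWeight_eq {n d : ℕ} {Δ : Set (PointedCone ℝ (Fin n → ℝ))} (c : conesOfDim Δ d → ℤ)
    {C : Set (Set (Ground n))} (h : flagCone C ∈ conesOfDim Δ d) :
    flagWeight c C = c ⟨flagCone C, h⟩ := dif_pos h

lemma exists_opposite_involution {n d : ℕ} {D : Set (Set (Ground n))} (hDd : D.ncard + 1 = d) :
    ∃ i : flagExtensions d D → flagExtensions d D, Function.Involutive i ∧
      ∀ G, IsOpposite D G.1 (i G).1 ∧ coneSupport (flagCone (insert (i G).1 D)) =
        coneSupport (flagCone (insert G.1 D)) := by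
  choose i hi hopp hsupp f hf0 hf1 hf using
    fun G : flagExtensions d D => exists_opposite hDd G.2
  refine ⟨fun G => ⟨i G, hi G⟩, fun G => ?_, fun G => ⟨hopp G, hsupp G⟩⟩
  set G' : flagExtensions d D := ⟨i G, hi G⟩ with hG'
  -- If `G` were not the opposite of `G'`, the functional of `G'` would vanish at `G`, yet its
  -- values at `G` and `G'` sum to `0` and the latter is `1`.
  by_contra hne
  have h1 := linearMap_eq_zero_of_mem_span (hf0 G') (hopp G)
  have h2 : f G' (signedVec (i G)) = 1 := hf1 G'
  rw [map_add, h2] at h1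
  have h3 : G.1 ≠ G'.1 := by
    intro h
    rw [h, h2] at h1
    norm_num at h1
  rw [hf G' G.1 G.2 h3 fun h => hne (Subtype.ext h.symm)] at h1
  norm_num at h1

/-- Reindexing the sum by the opposite involution and adding gives twice the sum as a combination of
opposite pairs, each in the span. -/
lemma isBalanced_of_coneSupport {n d : ℕ} {Δ : Set (PointedCone ℝ (Fin n → ℝ))}
    (hΔ : IsFlagFan d Δ) {c : conesOfDim Δ d → ℤ}
    (hc : ∀ σ σ' : conesOfDim Δ d, coneSupport σ.1 = coneSupport σ'.1 → c σ = c σ') :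
    IsBalanced Δ d c := by
  rw [isBalanced_iff hΔ]
  intro D hD hDd
  obtain ⟨i, hi, hi'⟩ := exists_opposite_involution hDd
  have := Fintype.ofFinite (flagExtensions d D)
  rw [finsum_eq_sum_of_fintype]
  set S := ∑ G : flagExtensions d D, flagWeight c (insert G.1 D) • signedVec G.1 with hS
  have hw : ∀ G, flagWeight c (insert (i G).1 D) = flagWeight c (insert G.1 D) := by
    intro G
    rw [flagWeight_eq c (hΔ.flagCone_insert_mem hDd G.2),
      flagWeight_eq c (hΔ.flagCone_insert_mem hDd (i G).2)]
    exact hc _ _ (hi' G).2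
  have hSi : S = ∑ G : flagExtensions d D, flagWeight c (insert G.1 D) • signedVec (i G).1 := by
    rw [hS, ← Equiv.sum_comp hi.toPerm]
    refine Finset.sum_congr rfl fun G _ => ?_
    rw [Function.Involutive.coe_toPerm, hw]
  have hSS : S + S ∈ Submodule.span ℝ (signedVec '' D) := by
    nth_rewrite 2 [hSi]
    rw [hS, ← Finset.sum_add_distrib]
    refine Submodule.sum_mem _ fun G _ => ?_
    rw [← smul_add]
    exact zsmul_mem (hi' G).1 _
  rw [← two_smul ℝ] at hSS
  exact (Submodule.smul_mem_iff _ two_ne_zero).1 hSS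

/-- The functional of `exists_opposite` sends the balancing relation to the difference of the two
weights. -/
lemma IsBalanced.flagWeight_eq_of_isOpposite {n d : ℕ} {Δ : Set (PointedCone ℝ (Fin n → ℝ))}
    (hΔ : IsFlagFan d Δ) {c : conesOfDim Δ d → ℤ} (hc : IsBalanced Δ d c)
    {D : Set (Set (Ground n))} (hDd : D.ncard + 1 = d) {G G' : Set (Ground n)}
    (hG : G ∈ flagExtensions d D) (hG' : G' ∈ flagExtensions d D) (h : IsOpposite D G G') :
    flagWeight c (insert G D) = flagWeight c (insert G' D) := by
  classical
  obtain ⟨H, hH, -, -, f, hf0, hf1, hf⟩ := exists_opposite hDd hG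
  have hfG' : f (signedVec G') = -1 := by
    have h1 := linearMap_eq_zero_of_mem_span hf0 h
    rw [map_add, hf1] at h1
    linarith
  have hne : G ≠ G' := by
    rintro rfl
    rw [hf1] at hfG'
    norm_num at hfG'
  have hHG' : G' = H := by
    by_contra hcon
    rw [hf G' hG' hne.symm hcon] at hfG'
    norm_num at hfG'
  subst hHG'
  have := Fintype.ofFinite (flagExtensions d D)
  have hbal := (isBalanced_iff hΔ c).1 hc D (hG.2.mono (Set.subset_insert _ _)) hDd
  rw [finsum_eq_sum_of_fintype] at hbal
  have h0 := linearMap_eq_zero_of_mem_span hf0 hbal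
  rw [map_sum, Fintype.sum_eq_add (⟨G, hG⟩ : flagExtensions d D) ⟨G', hG'⟩] at h0
  · rw [map_zsmul, map_zsmul, hf1, hfG', zsmul_eq_mul, zsmul_eq_mul] at h0
    have h1 : (flagWeight c (insert G D) : ℝ) = flagWeight c (insert G' D) := by linarith
    exact_mod_cast h1
  · exact fun h => hne (congrArg Subtype.val h)
  · rintro K ⟨hK1, hK2⟩
    rw [map_zsmul, hf K.1 K.2 (fun h => hK1 (Subtype.ext h)) (fun h => hK2 (Subtype.ext h)),
      smul_zero]

lemma listFlag_mem_conesOfDim {n d : ℕ} {Δ : Set (PointedCone ℝ (Fin n → ℝ))}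
    (hΔ : IsFlagFan d Δ) {l : List (Ground n)} (hl : (l.map index).Nodup) (hd : l.length = d) :
    flagCone (listFlag l) ∈ conesOfDim Δ d :=
  hΔ.mem_conesOfDim_iff.2 ⟨_, isFlag_listFlag hl hd.le, by rw [ncard_listFlag hl, hd], rfl⟩

lemma mem_flagExtensions_of_insert {n d : ℕ} {D : Set (Set (Ground n))} {G : Set (Ground n)}
    {l : List (Ground n)} (hl : (l.map index).Nodup) (hd : l.length = d)
    (h : insert G D = listFlag l) (hG : G ∉ D) : G ∈ flagExtensions d D :=
  ⟨hG, h ▸ isFlag_listFlag hl hd.le⟩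

lemma ncard_add_one_of_insert {n d : ℕ} {D : Set (Set (Ground n))} {G : Set (Ground n)}
    {l : List (Ground n)} (hl : (l.map index).Nodup) (hd : l.length = d)
    (h : insert G D = listFlag l) (hG : G ∉ D) : D.ncard + 1 = d := by
  rw [← hd, ← ncard_listFlag hl, ← h, Set.ncard_insert_of_notMem hG]

lemma IsBalanced.flagWeight_star_cons {n d : ℕ} {Δ : Set (PointedCone ℝ (Fin n → ℝ))}
    (hΔ : IsFlagFan d Δ) {c : conesOfDim Δ d → ℤ} (hc : IsBalanced Δ d c) {a : Ground n}
    {q : List (Ground n)} (hl : ((a :: q).map index).Nodup) (hd : (a :: q).length = d) :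
    flagWeight c (listFlag (a :: q)) = flagWeight c (listFlag (star a :: q)) := by
  have hnot := notMem_of_nodup_index_cons hl
  have hl' : ((star a :: q).map index).Nodup := by simpa using hl
  have h1 := listSet_notMem_listFlag hnot.1
  have h2 := listSet_notMem_listFlag hnot.2
  exact hc.flagWeight_eq_of_isOpposite hΔ (ncard_add_one_of_insert hl hd rfl h1)
    (mem_flagExtensions_of_insert hl hd rfl h1) (mem_flagExtensions_of_insert hl' hd rfl h2)
    (signedVec_cons_add_star_cons hl)

lemma IsBalanced.flagWeight_swap {n d : ℕ} {Δ : Set (PointedCone ℝ (Fin n → ℝ))}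
    (hΔ : IsFlagFan d Δ) {c : conesOfDim Δ d → ℤ} (hc : IsBalanced Δ d c) {a b : Ground n}
    {p q : List (Ground n)} (hl : ((p ++ b :: a :: q).map index).Nodup)
    (hd : (p ++ b :: a :: q).length = d) :
    flagWeight c (listFlag (p ++ b :: a :: q)) = flagWeight c (listFlag (p ++ a :: b :: q)) := by
  have hl' := nodup_index_swap hl
  have hd' : (p ++ a :: b :: q).length = d := by simpa using hd
  have h1 := listSet_notMem_swapFlag hl.of_map
  have h2 := listSet_notMem_swapFlag hl'.of_map
  have e1 := insert_swapFlag p b a q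
  have e2 := insert_swapFlag p a b q
  rw [← swapFlag_comm] at h2 e2
  rw [← e1, ← e2]
  exact hc.flagWeight_eq_of_isOpposite hΔ (ncard_add_one_of_insert hl hd e1 h1)
    (mem_flagExtensions_of_insert hl hd e1 h1) (mem_flagExtensions_of_insert hl' hd' e2 h2)
    (signedVec_swap_mem hl)

/-- The prefix `p` is universally quantified so that the `cons` case can absorb the common head. -/
lemma IsBalanced.flagWeight_perm {n d : ℕ} {Δ : Set (PointedCone ℝ (Fin n → ℝ))}
    (hΔ : IsFlagFan d Δ) {c : conesOfDim Δ d → ℤ} (hc : IsBalanced Δ d c)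
    {l l' : List (Ground n)} (h : l.Perm l') : ∀ p : List (Ground n),
    ((p ++ l).map index).Nodup → (p ++ l).length = d →
    flagWeight c (listFlag (p ++ l)) = flagWeight c (listFlag (p ++ l')) := by
  induction h with
  | nil => exact fun _ _ _ => rfl
  | cons x _ ih =>
    intro p hl hd
    simpa using ih (p ++ [x]) (by simpa using hl) (by simpa using hd)
  | swap x y l => exact fun p hl hd => hc.flagWeight_swap hΔ hl hd
  | trans h1 _ ih1 ih2 =>
    intro p hl hd
    rw [ih1 p hl hd]
    exact ih2 p (((h1.append_left p).map index).nodup_iff.1 hl)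
      ((h1.append_left p).length_eq ▸ hd)

/-- A sign can be changed only at the head, so each entry is made positive there and then moved into
`q`. -/
lemma IsBalanced.flagWeight_map_inl {n d : ℕ} {Δ : Set (PointedCone ℝ (Fin n → ℝ))}
    (hΔ : IsFlagFan d Δ) {c : conesOfDim Δ d → ℤ} (hc : IsBalanced Δ d c)
    (l q : List (Ground n)) (hl : ((l ++ q).map index).Nodup) (hd : (l ++ q).length = d) :
    flagWeight c (listFlag (l ++ q)) =
      flagWeight c (listFlag ((l.map index).map Sum.inl ++ q)) := by
  induction l generalizing q with
  | nil => rfl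
  | cons a l ih =>
    have h1 : flagWeight c (listFlag (a :: (l ++ q))) =
        flagWeight c (listFlag (Sum.inl (index a) :: (l ++ q))) := by
      cases a with
      | inl i => rfl
      | inr i => exact hc.flagWeight_star_cons hΔ hl hd
    have hl' : ((Sum.inl (index a) :: (l ++ q)).map index).Nodup := by simpa using hl
    have hd' : (Sum.inl (index a) :: (l ++ q)).length = d := by simpa using hd
    have hperm : (Sum.inl (index a) :: (l ++ q)).Perm (l ++ Sum.inl (index a) :: q) :=
      List.perm_middle.symm
    have hl2 := (hperm.map index).nodup_iff.1 hl'
    have hd2 := hperm.length_eq ▸ hd'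
    rw [List.cons_append, h1]
    rw [show flagWeight c (listFlag (Sum.inl (index a) :: (l ++ q))) = _ from
      hc.flagWeight_perm hΔ hperm [] hl' hd', List.nil_append, ih _ hl2 hd2]
    refine hc.flagWeight_perm hΔ (l' := Sum.inl (index a) :: ((l.map index).map Sum.inl ++ q))
      List.perm_middle [] ?_ ?_
    · simpa [Function.comp_def] using hl2
    · simpa using hd2

lemma IsBalanced.flagWeight_eq_toList {n d : ℕ} {Δ : Set (PointedCone ℝ (Fin n → ℝ))}
    (hΔ : IsFlagFan d Δ) {c : conesOfDim Δ d → ℤ} (hc : IsBalanced Δ d c)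
    {l : List (Ground n)} (hl : (l.map index).Nodup) (hd : l.length = d) :
    flagWeight c (listFlag l) =
      flagWeight c (listFlag ((l.map index).toFinset.toList.map Sum.inl)) := by
  have h := hc.flagWeight_map_inl hΔ l [] (by simpa using hl) (by simpa using hd)
  rw [List.append_nil, List.append_nil] at h
  rw [h]
  refine hc.flagWeight_perm hΔ ((List.toFinset_toList hl).symm.map _) [] ?_ ?_
  · simpa [Function.comp_def] using hl
  · simpa using hd

lemma card_coneSupport {n d : ℕ} {Δ : Set (PointedCone ℝ (Fin n → ℝ))}
    (hΔ : IsFlagFan d Δ) (σ : conesOfDim Δ d) : (coneSupport σ.1).card = d := by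
  obtain ⟨C, hC, hCd, hσ⟩ := hΔ.mem_conesOfDim_iff.1 σ.2
  obtain ⟨l, hl, hld, rfl⟩ := hC.exists_eq_listFlag hCd
  rw [hσ, coneSupport_flagCone_listFlag hl, List.toFinset_card_of_nodup hl, List.length_map, hld]

lemma nodup_index_map_inl {n : ℕ} (s : Finset (Fin n)) :
    ((s.toList.map (Sum.inl : Fin n → Ground n)).map index).Nodup := by
  simpa [Function.comp_def] using s.nodup_toList

lemma coneSupport_toList {n : ℕ} (s : Finset (Fin n)) :
    coneSupport (flagCone (listFlag (s.toList.map (Sum.inl : Fin n → Ground n)))) = s := by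
  rw [coneSupport_flagCone_listFlag (nodup_index_map_inl s)]
  simp [Function.comp_def]

/-- The Minkowski weight given by a function on the coordinate subspaces of dimension `d`. -/
noncomputable def weightOfSupport {n d : ℕ} {Δ : Set (PointedCone ℝ (Fin n → ℝ))} [Finite Δ]
    (hΔ : IsFlagFan d Δ) : ({s : Finset (Fin n) // s.card = d} → ℤ) →+ minkowskiWeights Δ d where
  toFun f := ⟨fun σ => f ⟨coneSupport σ.1, card_coneSupport hΔ σ⟩,
    isBalanced_of_coneSupport hΔ fun _ _ h => congrArg f (Subtype.ext h)⟩
  map_zero' := rfl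
  map_add' _ _ := rfl

/-- Each `d`-subset is the support of its positive flag, giving injectivity; conversely a balanced
weight is recovered from its values on these flags. -/
lemma weightOfSupport_bijective {n d : ℕ} {Δ : Set (PointedCone ℝ (Fin n → ℝ))} [Finite Δ]
    (hΔ : IsFlagFan d Δ) : Function.Bijective (weightOfSupport hΔ) := by
  constructor
  · intro f g h
    funext s
    have hmem := listFlag_mem_conesOfDim hΔ (nodup_index_map_inl s.1) (by simp [s.2])
    have h1 := congrFun (congrArg Subtype.val h) ⟨_, hmem⟩
    have hs : (⟨coneSupport _, card_coneSupport hΔ ⟨_, hmem⟩⟩ :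
      {s : Finset (Fin n) // s.card = d}) = s := Subtype.ext (coneSupport_toList s.1)
    simp only [weightOfSupport, AddMonoidHom.coe_mk, ZeroHom.coe_mk] at h1
    rwa [hs] at h1
  · rintro ⟨c, hc⟩
    refine ⟨fun s => flagWeight c (listFlag (s.1.toList.map Sum.inl)), Subtype.ext ?_⟩
    funext σ
    obtain ⟨σ, hσ⟩ := σ
    obtain ⟨C, hC, hCd, rfl⟩ := hΔ.mem_conesOfDim_iff.1 hσ
    obtain ⟨l, hl, hld, rfl⟩ := hC.exists_eq_listFlag hCd
    change flagWeight c (listFlag ((coneSupport (flagCone (listFlag l))).toList.map Sum.inl)) = _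
    rw [coneSupport_flagCone_listFlag hl,
      ← IsBalanced.flagWeight_eq_toList hΔ hc hl hld, flagWeight_eq c hσ]

lemma nonempty_minkowskiWeights_addEquiv {n d : ℕ} {Δ : Set (PointedCone ℝ (Fin n → ℝ))}
    [Finite Δ] (hΔ : IsFlagFan d Δ) :
    Nonempty (minkowskiWeights Δ d ≃+ (Fin (n.choose d) → ℤ)) := by
  have hcard : Fintype.card {s : Finset (Fin n) // s.card = d} = n.choose d := by
    simp
  exact ⟨(AddEquiv.ofBijective _ (weightOfSupport_bijective hΔ)).symm.trans
    (LinearEquiv.funCongrLeft ℤ ℤ (Fintype.equivFinOfCardEq hcard).symm).toAddEquiv⟩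

/-! ### The uniform case and the comparison with `ℤ` -/

lemma isFlagFan_bergmanFan {k n : ℕ} (hk : 1 ≤ k) (hkn : k ≤ n) :
    IsFlagFan (k - 1) (bergmanFan (uniformEnvelope k n)) := by
  have hn : 1 ≤ n := hk.trans hkn
  have hflats : ∀ F : Set (Ground n),
      F ∈ latticeOfFlats (uniformEnvelope k n) \ {∅, Set.univ} ↔
        Admissible F ∧ F.Nonempty ∧ F.ncard ≤ k - 1 := by
    intro F
    have h1 : F ∈ latticeOfFlats (uniformEnvelope k n) ↔
        (Admissible F ∧ F.ncard < k) ∨ F = Set.univ :=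
      or_congr (uniformEnvelope_flat_admissible_iff hn) Iff.rfl
    rw [Set.mem_sdiff, h1, Set.mem_insert_iff, Set.mem_singleton_iff, not_or,
      Set.nonempty_iff_ne_empty]
    constructor
    · rintro ⟨⟨h, h'⟩ | h, h2, h3⟩
      · exact ⟨h, h2, by omega⟩
      · exact absurd h h3
    · rintro ⟨h, h2, h3⟩
      refine ⟨Or.inl ⟨h, by omega⟩, h2, ?_⟩
      rintro rfl
      exact not_admissible_univ hn h
  intro σ
  constructor
  · rintro ⟨C, hC, hchain, rfl⟩
    have hC' := fun F hF => (hflats F).1 (hC hF)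
    exact ⟨C, ⟨fun F hF => (hC' F hF).1, fun F hF => (hC' F hF).2.1,
      fun F hF => (hC' F hF).2.2, hchain⟩, rfl⟩
  · rintro ⟨C, hC, rfl⟩
    exact ⟨C, fun F hF => (hflats F).2 ⟨hC.admissible F hF, hC.nonempty F hF, hC.ncard_le F hF⟩,
      hC.chain, rfl⟩

lemma isEmpty_addEquiv_int {A : Type*} [AddCommGroup A] {m : ℕ} (hm : m ≠ 1)
    (e : A ≃+ (Fin m → ℤ)) : IsEmpty (A ≃+ ℤ) := by
  refine ⟨fun e' => hm ?_⟩
  have h := (e.symm.trans e').toIntLinearEquiv.finrank_eq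
  simpa using h

lemma choose_pred_ne_one {n k : ℕ} (hk : 2 ≤ k) (hkn : k ≤ n) : n.choose (k - 1) ≠ 1 := by
  rw [Ne, Nat.choose_eq_one_iff]
  omega

end SympMatroid

theorem lemma5p14 (n k : ℕ) (hk : 1 ≤ k) (hkn : k ≤ n) :
    (∃! M : Matroid (SympMatroid.Ground n),
      SympMatroid.IsEnvelopingMatroid (SympMatroid.uniform k n) M) ∧
    ∀ M : Matroid (SympMatroid.Ground n),
      SympMatroid.IsEnvelopingMatroid (SympMatroid.uniform k n) M →
      Nonempty (SympMatroid.minkowskiWeights (SympMatroid.bergmanFan M) (k - 1) ≃+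
        (Fin (n.choose (k - 1)) → ℤ)) ∧
      (2 ≤ k →
        IsEmpty (SympMatroid.minkowskiWeights (SympMatroid.bergmanFan M) (k - 1) ≃+ ℤ)) := by
  have henv := SympMatroid.uniformEnvelope_isEnvelopingMatroid hk hkn
  refine ⟨⟨_, henv, fun M hM => hM.unique henv⟩, fun M hM => ?_⟩
  obtain rfl := hM.unique henv
  obtain ⟨e⟩ := SympMatroid.nonempty_minkowskiWeights_addEquiv (SympMatroid.isFlagFan_bergmanFan hk hkn)
  exact ⟨⟨e⟩, fun hk2 => SympMatroid.isEmpty_addEquiv_int (SympMatroid.choose_pred_ne_one hk2 hkn) e⟩
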